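/- **Setting.** Let $\mathcal H_A,\mathcal H_B$ be Hilbert spaces of finite dimensions $d_A,d_B\ge 1$. An *ensemble* of unitaries on $\mathcal H_A\otimes\mathcal H_B$ is a Borel probability measure $\nu$ on the unitary group $\mathcal U(d_Ad_B)$ (for instance the uniform distribution on a finite set of unitaries). It is a *unitary $2$-design* if $$\int P(V)\,d\nu(V)=\int_{\mathcal U(d_Ad_B)}P(V)\,d\mu(V)$$ for every complex polynomial $P$ of degree at most $2$ in the entries of $V$ and at most $2$ in the entries of $V^\dagger$, where $\mu$ is the normalized Haar measure. Let $H$ be a Hermitian operator and $\rho$ a density matrix (positive semidefinite, trace one) on $\mathcal H_A\otimes\mathcal H_B$. Let $w(H)=\lambda_{\max}(H)-\lambda_{\min}(H)$ be the spectral width of $H$. For unitaries $V_1,V_2$ on $\mathcal H_A\otimes\mathcal H_B$ and $U_A\in\mathcal U(d_A)$, put $\mathbf U=V_2(U_A\otimes I_B)V_1$ and $$\Delta_{H,\rho}(V_1,V_2)=\max_{U_A\in\mathcal U(d_A)}\operatorname{tr}(H\mathbf U\rho\mathbf U^\dagger)-\min_{U_A\in\mathcal U(d_A)}\operatorname{tr}(H\mathbf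 U\rho\mathbf U^\dagger).$$ **Theorem.** Let $V_1,V_2$ be sampled independently from ensembles $\mathbb V_1,\mathbb V_2$, at least one of which is a unitary $2$-design. Then $\Delta_{H,\rho}$ is integrable and $$\mathbb E_{V_1,V_2}[\Delta_{H,\rho}(V_1,V_2)]\le 4\,w(H)\,d_A^2\sqrt{\frac{d_A}{d_B}},$$ $$\operatorname{Var}_{V_1,V_2}[\Delta_{H,\rho}(V_1,V_2)]\le 4\,w(H)^2\,d_A^2\sqrt{\frac{d_A}{d_B}},$$ and, for every $\epsilon>0$, $$\Pr[\Delta_{H,\rho}(V_1,V_2)\ge\epsilon]\le\frac{4\,w(H)\,d_A^2}{\epsilon}\sqrt{\frac{d_A}{d_B}}.$$ In particular, for a system of $n$ qubits of which $m\le n$ belong to $A$ ($d_A=2^m$, $d_B=2^{n-m}$), $$\mathbb E[\Delta_{H,\rho}]\le\frac{w(H)}{2^{n/2-3m-2}},\qquad \operatorname{Var}[\Delta_{H,\rho}]\le\frac{w(H)^2}{2^{n/2-3m-2}},\qquad \Pr[\Delta_{H,\rho}\ge\epsilon]\le\frac1\epsilon\cdot\frac{w(H)}{2^{n/2-3m-2}}\quad(\epsilon>0).$$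 -/

import Mathlib

open MeasureTheory ProbabilityTheory
open scoped Matrix Kronecker

namespace VQA

/-! ### The unitary group as a compact topological group with its Borel structure -/

/-- The Borel `σ`-algebra on the unitary group `U(ι)`. -/
noncomputable instance instMeasurableSpaceUnitary {ι : Type*} [Fintype ι] [DecidableEq ι] :
    MeasurableSpace (Matrix.unitaryGroup ι ℂ) :=
  borel _

instance instBorelSpaceUnitary {ι : Type*} [Fintype ι] [DecidableEq ι] :
    BorelSpace (Matrix.unitaryGroup ι ℂ) :=
  ⟨rfl⟩

instance instCompactSpaceUnitary {ι : Type*} [Fintype ι] [DecidableEq ι] :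
    CompactSpace (Matrix.unitaryGroup ι ℂ) := by
  apply isCompact_iff_compactSpace.mp
  have hK : IsCompact
      (Set.univ.pi fun _ : ι => Set.univ.pi fun _ : ι => Metric.closedBall (0 : ℂ) 1) :=
    isCompact_univ_pi fun _ => isCompact_univ_pi fun _ => isCompact_closedBall _ _
  refine IsCompact.of_isClosed_subset hK
    (isClosed_unitary (R := Matrix ι ι ℂ)) fun U hU i _ j _ => ?_
  rw [mem_closedBall_zero_iff]
  exact entry_norm_bound_of_unitary hU i j

/-- The normalized Haar measure on the unitary group: total mass one. -/
noncomputable def haarUnitary (ι : Type*) [Fintype ι] [DecidableEq ι] :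
    Measure (Matrix.unitaryGroup ι ℂ) :=
  Measure.haarMeasure ⊤

/-! ### Unitary designs -/

/-- Polynomials in two families of variables, standing for the entries of `V` (left) and of `Vᴴ`
(right), of degree at most `t` in the first family and at most `t` in the second. -/
def HasBidegreeLE {ι : Type*} [Fintype ι] (t : ℕ)
    (P : MvPolynomial ((ι × ι) ⊕ (ι × ι)) ℂ) : Prop :=
  ∀ s ∈ P.support, (∑ e : ι × ι, s (Sum.inl e)) ≤ t ∧ (∑ e : ι × ι, s (Sum.inr e)) ≤ t

/-- The value of such a polynomial at the entries of `V` and of `Vᴴ`. -/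
noncomputable def evalAt {ι : Type*} (P : MvPolynomial ((ι × ι) ⊕ (ι × ι)) ℂ)
    (V : Matrix ι ι ℂ) : ℂ :=
  MvPolynomial.eval (Sum.elim (fun e => V e.1 e.2) (fun e => Vᴴ e.1 e.2)) P

/-- An ensemble of unitaries, given by its law `ν` on the unitary group (the uniform law on a finite
set of unitaries being a special case), is a unitary `t`-design if every polynomial of degree at
most `t` in the entries of `V` and at most `t` in those of `Vᴴ` has the same average over the
ensemble as over the Haar measure. -/
def IsUnitaryDesign {ι : Type*} [Fintype ι] [DecidableEq ι] (t : ℕ)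
    (ν : Measure (Matrix.unitaryGroup ι ℂ)) : Prop :=
  ∀ P : MvPolynomial ((ι × ι) ⊕ (ι × ι)) ℂ, HasBidegreeLE t P →
    ∫ V, evalAt P V.1 ∂ν = ∫ V, evalAt P V.1 ∂(haarUnitary ι)

/-! ### The cost function and its variation range -/

section Density

open scoped ComplexOrder

/-- A density matrix: positive semidefinite of trace one. -/
def IsDensityMatrix {ι : Type*} [Fintype ι] (ρ : Matrix ι ι ℂ) : Prop :=
  ρ.PosSemidef ∧ ρ.trace = 1

end Density

/-- The spectral width `λ_max(H) - λ_min(H)` of a Hermitian matrix. -/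
noncomputable def spectralWidth {ι : Type*} [Fintype ι] [DecidableEq ι] (H : Matrix ι ι ℂ) : ℝ :=
  sSup (spectrum ℝ H) - sInf (spectrum ℝ H)

/-- The circuit `V₂ (U_A ⊗ I_B) V₁`. -/
noncomputable def circuit {A B : Type*} [Fintype A] [DecidableEq A] [Fintype B] [DecidableEq B]
    (V₁ V₂ : Matrix.unitaryGroup (A × B) ℂ) (UA : Matrix.unitaryGroup A ℂ) :
    Matrix (A × B) (A × B) ℂ :=
  V₂.1 * (UA.1 ⊗ₖ (1 : Matrix B B ℂ)) * V₁.1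

/-- The cost function `tr (H U ρ U†)`; this trace is real for Hermitian `H` and `ρ`. -/
noncomputable def cost {ι : Type*} [Fintype ι] (H ρ U : Matrix ι ι ℂ) : ℝ :=
  (H * U * ρ * Uᴴ).trace.re

/-- The variation range: maximum minus minimum of the cost over all unitaries `U_A` (both are
attained, see `exists_isMaxOn_cost` and `exists_isMinOn_cost`). -/
noncomputable def variationRange {A B : Type*} [Fintype A] [DecidableEq A] [Fintype B]
    [DecidableEq B] (H ρ : Matrix (A × B) (A × B) ℂ)
    (V : Matrix.unitaryGroup (A × B) ℂ × Matrix.unitaryGroup (A × B) ℂ) : ℝ :=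
  (⨆ UA : Matrix.unitaryGroup A ℂ, cost H ρ (circuit V.1 V.2 UA)) -
    ⨅ UA : Matrix.unitaryGroup A ℂ, cost H ρ (circuit V.1 V.2 UA)

theorem continuous_cost_circuit {A B : Type*} [Fintype A] [DecidableEq A] [Fintype B]
    [DecidableEq B] (H ρ : Matrix (A × B) (A × B) ℂ) (V₁ V₂ : Matrix.unitaryGroup (A × B) ℂ) :
    Continuous fun UA : Matrix.unitaryGroup A ℂ => cost H ρ (circuit V₁ V₂ UA) := by
  have hk : Continuous fun UA : Matrix.unitaryGroup A ℂ => UA.1 ⊗ₖ (1 : Matrix B B ℂ) := by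
    refine continuous_matrix fun i j => ?_
    simp only [Matrix.kroneckerMap_apply]
    exact (continuous_subtype_val.matrix_elem i.1 j.1).mul continuous_const
  have hc : Continuous fun UA : Matrix.unitaryGroup A ℂ => circuit V₁ V₂ UA :=
    (continuous_const.matrix_mul hk).matrix_mul continuous_const
  exact Complex.continuous_re.comp
    ((((continuous_const.matrix_mul hc).matrix_mul continuous_const).matrix_mul
      hc.matrix_conjTranspose).matrix_trace)

theorem exists_isMaxOn_cost {A B : Type*} [Fintype A] [DecidableEq A] [Fintype B]
    [DecidableEq B] (H ρ : Matrix (A × B) (A × B) ℂ) (V₁ V₂ : Matrix.unitaryGroup (A × B) ℂ) :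
    ∃ U₀ : Matrix.unitaryGroup A ℂ,
      (∀ UA, cost H ρ (circuit V₁ V₂ UA) ≤ cost H ρ (circuit V₁ V₂ U₀)) ∧
      cost H ρ (circuit V₁ V₂ U₀) = ⨆ UA, cost H ρ (circuit V₁ V₂ UA) := by
  obtain ⟨U₀, -, h⟩ := isCompact_univ.exists_isMaxOn Set.univ_nonempty
    (continuous_cost_circuit H ρ V₁ V₂).continuousOn
  have h' : ∀ UA, cost H ρ (circuit V₁ V₂ UA) ≤ cost H ρ (circuit V₁ V₂ U₀) :=
    fun UA => h (Set.mem_univ UA)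
  exact ⟨U₀, h', le_antisymm (le_ciSup ⟨_, Set.forall_mem_range.2 h'⟩ U₀) (ciSup_le h')⟩

theorem exists_isMinOn_cost {A B : Type*} [Fintype A] [DecidableEq A] [Fintype B]
    [DecidableEq B] (H ρ : Matrix (A × B) (A × B) ℂ) (V₁ V₂ : Matrix.unitaryGroup (A × B) ℂ) :
    ∃ U₀ : Matrix.unitaryGroup A ℂ,
      (∀ UA, cost H ρ (circuit V₁ V₂ U₀) ≤ cost H ρ (circuit V₁ V₂ UA)) ∧
      cost H ρ (circuit V₁ V₂ U₀) = ⨅ UA, cost H ρ (circuit V₁ V₂ UA) := by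
  obtain ⟨U₀, -, h⟩ := isCompact_univ.exists_isMinOn Set.univ_nonempty
    (continuous_cost_circuit H ρ V₁ V₂).continuousOn
  have h' : ∀ UA, cost H ρ (circuit V₁ V₂ U₀) ≤ cost H ρ (circuit V₁ V₂ UA) :=
    fun UA => h (Set.mem_univ UA)
  exact ⟨U₀, h', le_antisymm (le_ciInf h') (ciInf_le ⟨_, Set.forall_mem_range.2 h'⟩ U₀)⟩

end VQA

/-! Moving `V₁`, `V₂` onto `ρ`, `H` turns the cost into `tr (P (U_A ⊗ 1) Q (U_A ⊗ 1)ᴴ)` with `P =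
V₂ᴴ H V₂` and `Q = V₁ ρ V₁ᴴ`. Subtracting scalar matrices from `H` and `ρ` changes it only by a
constant independent of `U_A`. The trace is a sesquilinear form in the entries of `U_A`, whose
coefficients are `blockCoeff P Q`. Since `U_A` has squared Hilbert–Schmidt norm `d_A`,
Cauchy–Schwarz bounds the squared trace by `d_A²` times the sum of the squared coefficients,
uniformly in `U_A` (`norm_trace_sq_le`). The maximum over `U_A` is thereby removed before averaging.

Each coefficient is a linear functional of the matrix conjugated by the design, and its mean square
involves only second moments, so the design may be replaced by Haar measure. Invariance gives these
moments the form `a δ_ik δ_jl + c δ_ij δ_kl`; for a traceless `K` in dimension `d = d_A d_B` this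
yields `E |∑ X_ij G_ij|² ≤ 2 ‖K‖² ‖X‖² / d²` (`InvariantSecondMoments.integral_norm_sq_le`). With
`‖ρ‖² ≤ 1` and `‖H - midpoint‖² ≤ d w² / 4`, the result is `E Δ² ≤ 2 d_A⁴ w² / d`, stronger than
needed. The mean bound follows from `(E Δ)² ≤ E Δ²`, the variance bound from `0 ≤ Δ ≤ w`, the tail
bound from Markov. -/

namespace VQA

/-! ### Haar measure on the unitary group -/

/-- Second countability makes open sets of pairs `(V₁, V₂)` measurable for the product `σ`-algebra,
so continuous functions of the pair are measurable. -/
instance instSecondCountableUnitary {ι : Type*} [Fintype ι] [DecidableEq ι] :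
    SecondCountableTopology (Matrix.unitaryGroup ι ℂ) :=
  haveI : SecondCountableTopology (Matrix ι ι ℂ) :=
    inferInstanceAs (SecondCountableTopology (ι → ι → ℂ))
  TopologicalSpace.Subtype.secondCountableTopology (Matrix.unitaryGroup ι ℂ : Set (Matrix ι ι ℂ))

instance instIsHaarMeasureHaarUnitary {ι : Type*} [Fintype ι] [DecidableEq ι] :
    (haarUnitary ι).IsHaarMeasure := by
  unfold haarUnitary; infer_instance

instance instIsProbabilityMeasureHaarUnitary {ι : Type*} [Fintype ι] [DecidableEq ι] :
    IsProbabilityMeasure (haarUnitary ι) :=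
  ⟨by simpa [haarUnitary] using
    Measure.haarMeasure_self (K₀ := (⊤ : TopologicalSpace.PositiveCompacts
      (Matrix.unitaryGroup ι ℂ)))⟩

/-- A right translate is again a left Haar probability measure, hence equal to the original by
uniqueness. Right invariance serves the conjugations `Vᴴ K V`. -/
instance instIsMulRightInvariantHaarUnitary {ι : Type*} [Fintype ι] [DecidableEq ι] :
    (haarUnitary ι).IsMulRightInvariant := by
  refine ⟨fun g => ?_⟩
  have : IsProbabilityMeasure (Measure.map (· * g) (haarUnitary ι)) :=
    Measure.isProbabilityMeasure_map (measurable_mul_const g).aemeasurable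
  exact Measure.isHaarMeasure_eq_of_isProbabilityMeasure _ _

theorem integrable_of_continuous {X E : Type*} [TopologicalSpace X] [CompactSpace X]
    [MeasurableSpace X] [OpensMeasurableSpace X] [NormedAddCommGroup E] {μ : Measure X}
    [IsFiniteMeasure μ] {f : X → E} (hf : Continuous f) : Integrable f μ :=
  hf.integrable_of_hasCompactSupport (HasCompactSupport.of_compactSpace f)

/-! ### Second moments of unitarily invariant random matrices -/

theorem exists_perm_apply_eq_apply_eq {ι : Type*} [DecidableEq ι] {p q i j : ι}
    (hpq : p ≠ q) (hij : i ≠ j) :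
    ∃ σ : Equiv.Perm ι, σ p = i ∧ σ q = j := by
  refine ⟨(Equiv.swap p i).trans (Equiv.swap (Equiv.swap p i q) j), ?_, ?_⟩
  · have : i ≠ Equiv.swap p i q := by
      intro e
      apply hpq
      apply (Equiv.swap p i).injective
      rw [Equiv.swap_apply_left, ← e]
    simp [Equiv.swap_apply_of_ne_of_ne this hij]
  · simp

/-- The second moment `E[G i j * conj (G k l)]` of a random matrix. -/
noncomputable def secondMoment {Ω ι : Type*} [MeasurableSpace Ω] (μ : Measure Ω)
    (G : Ω → Matrix ι ι ℂ) (i j k l : ι) : ℂ :=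
  ∫ x, G x i j * star (G x k l) ∂μ

theorem integral_sum_mul_star_sum {Ω ι S : Type*} [MeasurableSpace Ω] [Fintype S]
    {μ : Measure Ω} {G : Ω → Matrix ι ι ℂ}
    (hG : ∀ i j k l, Integrable (fun x => G x i j * star (G x k l)) μ)
    (X : S → ℂ) (f g : S → ι) :
    ∫ x, (∑ s, X s * G x (f s) (g s)) * star (∑ s, X s * G x (f s) (g s)) ∂μ =
      ∑ s, ∑ t, X s * star (X t) * secondMoment μ G (f s) (g s) (f t) (g t) := by
  have e : ∀ x, (∑ s, X s * G x (f s) (g s)) * star (∑ s, X s * G x (f s) (g s)) =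
      ∑ s, ∑ t, X s * star (X t) * (G x (f s) (g s) * star (G x (f t) (g t))) := by
    intro x
    rw [star_sum, Finset.sum_mul_sum]
    refine Finset.sum_congr rfl fun s _ => Finset.sum_congr rfl fun t _ => ?_
    rw [star_mul']
    ring
  simp_rw [e]
  rw [integral_finsetSum _ fun s _ => integrable_finsetSum _ fun t _ => (hG _ _ _ _).const_mul _]
  refine Finset.sum_congr rfl fun s _ => ?_
  rw [integral_finsetSum _ fun t _ => (hG _ _ _ _).const_mul _]
  refine Finset.sum_congr rfl fun t _ => ?_
  rw [integral_const_mul]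
  rfl

/-- The reflection of the plane spanned by `e_p` and `e_q` with first row `(3/5, 4/5)`. -/
noncomputable def planeReflection {ι : Type*} [DecidableEq ι] (p q : ι) : Matrix ι ι ℂ :=
  1 - (2 / 5 : ℂ) • Matrix.vecMulVec (Pi.single p 1 - Pi.single q 2 : ι → ℂ)
    (Pi.single p 1 - Pi.single q 2 : ι → ℂ)

theorem planeReflection_apply {ι : Type*} [DecidableEq ι] {p q : ι} (hpq : p ≠ q)
    (x : ι) : planeReflection p q p x =
      3 / 5 * (Pi.single p 1 : ι → ℂ) x + 4 / 5 * (Pi.single q 1 : ι → ℂ) x := by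
  rcases eq_or_ne x p with rfl | hp
  · simp [planeReflection, Matrix.vecMulVec_apply, hpq]
    norm_num
  · rcases eq_or_ne x q with rfl | hq
    · simp [planeReflection, Matrix.vecMulVec_apply, hpq, hp]
      norm_num
    · simp [planeReflection, Matrix.vecMulVec_apply, hpq, hp, hq, hp.symm]

section Moments

variable {Ω ι : Type*} [MeasurableSpace Ω] [Fintype ι]

/-- The second moments of `G` are invariant under conjugation of `G` by unitary matrices. -/
def InvariantSecondMoments [DecidableEq ι] (μ : Measure Ω) (G : Ω → Matrix ι ι ℂ) : Prop :=
  ∀ W ∈ Matrix.unitaryGroup ι ℂ, ∀ i j k l,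
    secondMoment μ (fun x => W * G x * Wᴴ) i j k l = secondMoment μ G i j k l

variable [DecidableEq ι] {μ : Measure Ω} {G : Ω → Matrix ι ι ℂ}

theorem diagonal_mem_unitaryGroup {D : ι → ℂ} (hD : ∀ x, D x * star (D x) = 1) :
    Matrix.diagonal D ∈ Matrix.unitaryGroup ι ℂ := by
  rw [Matrix.mem_unitaryGroup_iff, Matrix.star_eq_conjTranspose, Matrix.diagonal_conjTranspose,
    Matrix.diagonal_mul_diagonal, ← Matrix.diagonal_one]
  congr 1
  funext x
  exact hD x

/-- Conjugation by a diagonal unitary multiplies the moment by a phase; whenever that phase can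
differ from 1, the moment must vanish. -/
theorem InvariantSecondMoments.secondMoment_phase (h : InvariantSecondMoments μ G) {D : ι → ℂ}
    (hD : ∀ x, D x * star (D x) = 1) (i j k l : ι) :
    secondMoment μ G i j k l =
      D i * star (D j) * star (D k) * D l * secondMoment μ G i j k l := by
  conv_lhs => rw [← h _ (diagonal_mem_unitaryGroup hD)]
  unfold secondMoment
  rw [← integral_const_mul]
  congr 1
  funext x
  simp only [Matrix.diagonal_conjTranspose, Matrix.mul_diagonal, Matrix.diagonal_mul,
    Pi.star_apply, star_mul', star_star]
  ring

theorem InvariantSecondMoments.secondMoment_eq_zero (h : InvariantSecondMoments μ G) {i j k l : ι}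
    (h₁ : ¬ (i = k ∧ j = l)) (h₂ : ¬ (i = j ∧ k = l)) : secondMoment μ G i j k l = 0 := by
  have key : ∀ p, (fun x => if x = p then Complex.I else 1 : ι → ℂ) i *
      star ((fun x => if x = p then Complex.I else 1 : ι → ℂ) j) *
      star ((fun x => if x = p then Complex.I else 1 : ι → ℂ) k) *
      (fun x => if x = p then Complex.I else 1 : ι → ℂ) l ≠ 1 → secondMoment μ G i j k l = 0 := by
    intro p hp
    have := h.secondMoment_phase (D := fun x => if x = p then Complex.I else 1)
      (fun x => by by_cases hx : x = p <;> simp [hx]) i j k l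
    by_contra h0
    exact hp (mul_right_cancel₀ h0 (by rw [← this, one_mul]))
  -- A single phase `I` at one index suffices. A sign `-1` would not: when `i = l` differs from `j`
  -- and `k`, the phase enters squared.
  have hI : Complex.I ≠ 1 := fun h => by simpa using congrArg Complex.re h
  have hI2 : (-1 : ℂ) ≠ 1 := by norm_num
  by_cases hij : i = j
  · subst hij
    have hkl : k ≠ l := fun e => h₂ ⟨rfl, e⟩
    refine key l ?_
    by_cases hil : i = l <;> simp [hil, hkl, hI]
  · by_cases hik : i = k
    · subst hik
      have hjl : j ≠ l := fun e => h₁ ⟨rfl, e⟩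
      refine key l ?_
      by_cases hil : i = l <;> simp [hil, hjl, hI]
    · refine key i ?_
      by_cases hli : l = i <;> simp [hli, Ne.symm hij, Ne.symm hik, hI, hI2]

/-- The matrix of the permutation `σ`, sending the basis vector `y` to `σ y`. -/
def permutation (σ : Equiv.Perm ι) : Matrix ι ι ℂ := fun x y => if x = σ y then 1 else 0

theorem permutation_mem_unitaryGroup (σ : Equiv.Perm ι) :
    permutation σ ∈ Matrix.unitaryGroup ι ℂ := by
  rw [Matrix.mem_unitaryGroup_iff']
  ext x y
  simp [permutation, Matrix.mul_apply, Matrix.star_apply, Matrix.one_apply, eq_comm]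

theorem permutation_conj_apply (σ : Equiv.Perm ι) (M : Matrix ι ι ℂ) (i j : ι) :
    (permutation σ * M * (permutation σ)ᴴ) (σ i) (σ j) = M i j := by
  simp [permutation, Matrix.mul_apply, Matrix.conjTranspose_apply]

theorem InvariantSecondMoments.secondMoment_perm (h : InvariantSecondMoments μ G)
    (σ : Equiv.Perm ι) (i j k l : ι) :
    secondMoment μ G (σ i) (σ j) (σ k) (σ l) = secondMoment μ G i j k l := by
  rw [← h _ (permutation_mem_unitaryGroup σ)]
  simp only [secondMoment, permutation_conj_apply]

/-- Householder reflection along `v = e_p - 2 e_q`: the factor `2/5` is `2 / (v ⬝ᵥ v)`. The choice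
of `v` keeps all entries rational. -/
theorem planeReflection_mem_unitaryGroup {p q : ι} (hpq : p ≠ q) :
    planeReflection p q ∈ Matrix.unitaryGroup ι ℂ := by
  have hs : star (planeReflection p q) = planeReflection p q := by
    ext x y
    simp [planeReflection, Matrix.star_apply, Matrix.vecMulVec_apply, Matrix.one_apply, eq_comm,
      Pi.single_apply, apply_ite (starRingEnd ℂ), Complex.conj_ofNat]
    left
    ring
  set v : ι → ℂ := Pi.single p 1 - Pi.single q 2 with hv
  have hvv : v ⬝ᵥ v = 5 := by
    simp [hv, dotProduct_sub, hpq, hpq.symm]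
    norm_num
  rw [Matrix.mem_unitaryGroup_iff, hs, planeReflection, ← hv]
  have : Matrix.vecMulVec v v * Matrix.vecMulVec v v = (5 : ℂ) • Matrix.vecMulVec v v := by
    rw [Matrix.vecMulVec_mul_vecMulVec, hvv, Matrix.vecMulVec_smul]
  simp only [sub_mul, mul_sub, one_mul, mul_one, smul_mul_assoc, mul_smul_comm, this, smul_smul]
  module

theorem planeReflection_conj_apply {p q : ι} (hpq : p ≠ q) (M : Matrix ι ι ℂ) :
    (planeReflection p q * M * (planeReflection p q)ᴴ) p p =
      ∑ s : Fin 2 × Fin 2, (![3 / 5, 4 / 5] s.1 * ![3 / 5, 4 / 5] s.2 : ℂ) *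
        M (![p, q] s.1) (![p, q] s.2) := by
  simp only [Matrix.mul_apply, Matrix.conjTranspose_apply, planeReflection_apply hpq,
    Fintype.sum_prod_type, Fin.sum_univ_two]
  simp [add_mul, mul_add, Finset.sum_add_distrib, Pi.single_apply,
    apply_ite (starRingEnd ℂ), Complex.conj_ofNat]
  ring

/-- Phases and permutations leave the fully diagonal moment undetermined; a rotation mixing two
basis vectors supplies the missing relation. -/
theorem InvariantSecondMoments.secondMoment_diag (h : InvariantSecondMoments μ G)
    (hG : ∀ i j k l, Integrable (fun x => G x i j * star (G x k l)) μ) {p q : ι} (hpq : p ≠ q) :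
    secondMoment μ G p p p p = secondMoment μ G p q p q + secondMoment μ G p p q q := by
  have e := h _ (planeReflection_mem_unitaryGroup hpq) p p p p
  conv_lhs at e => unfold secondMoment
  simp only [planeReflection_conj_apply hpq] at e
  rw [integral_sum_mul_star_sum hG] at e
  have z : ∀ {i j k l : ι}, ¬ (i = k ∧ j = l) → ¬ (i = j ∧ k = l) →
    secondMoment μ G i j k l = 0 := fun h₁ h₂ => h.secondMoment_eq_zero h₁ h₂
  have e₁ : secondMoment μ G q q q q = secondMoment μ G p p p p := by
    simpa using h.secondMoment_perm (Equiv.swap p q) p p p p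
  have e₂ : secondMoment μ G q p q p = secondMoment μ G p q p q := by
    simpa using h.secondMoment_perm (Equiv.swap p q) p q p q
  have e₃ : secondMoment μ G q q p p = secondMoment μ G p p q q := by
    simpa using h.secondMoment_perm (Equiv.swap p q) p p q q
  simp only [Fintype.sum_prod_type, Fin.sum_univ_two, Matrix.cons_val_zero, Matrix.cons_val_one,
    e₁, e₂, e₃] at e
  rw [z (i := p) (j := p) (k := p) (l := q) (by simp [hpq]) (by simp [hpq]),
    z (i := p) (j := p) (k := q) (l := p) (by simp [hpq]) (by simp [hpq.symm]),
    z (i := p) (j := q) (k := p) (l := p) (by simp [hpq.symm]) (by simp [hpq]),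
    z (i := p) (j := q) (k := q) (l := p) (by simp [hpq]) (by simp [hpq]),
    z (i := p) (j := q) (k := q) (l := q) (by simp [hpq]) (by simp [hpq]),
    z (i := q) (j := p) (k := p) (l := p) (by simp [hpq.symm]) (by simp [hpq.symm]),
    z (i := q) (j := p) (k := p) (l := q) (by simp [hpq.symm]) (by simp [hpq.symm]),
    z (i := q) (j := p) (k := q) (l := q) (by simp [hpq]) (by simp [hpq.symm]),
    z (i := q) (j := q) (k := p) (l := q) (by simp [hpq.symm]) (by simp [hpq]),
    z (i := q) (j := q) (k := q) (l := p) (by simp [hpq.symm]) (by simp [hpq.symm])] at e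
  simp only [star_mul', star_div₀, star_ofNat] at e
  -- The diagonal moments carry weight `(3/5)⁴ + (4/5)⁴ = 337/625`, the two mixed ones `2 (3/5 ·
  -- 4/5)² = 288/625` each; and `1 - 337/625 = 288/625`.
  linear_combination (625 / 288 : ℂ) * (-e)

theorem InvariantSecondMoments.exists_secondMoment_eq [Nontrivial ι]
    (h : InvariantSecondMoments μ G)
    (hG : ∀ i j k l, Integrable (fun x => G x i j * star (G x k l)) μ) :
    ∃ a c : ℂ, ∀ i j k l, secondMoment μ G i j k l =
      (if i = k ∧ j = l then a else 0) + if i = j ∧ k = l then c else 0 := by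
  obtain ⟨p, q, hpq⟩ := exists_pair_ne ι
  refine ⟨secondMoment μ G p q p q, secondMoment μ G p p q q, fun i j k l => ?_⟩
  have hoff : ∀ {i j : ι}, i ≠ j → secondMoment μ G i j i j = secondMoment μ G p q p q ∧
      secondMoment μ G i i j j = secondMoment μ G p p q q := by
    intro i j hij
    obtain ⟨σ, rfl, rfl⟩ := exists_perm_apply_eq_apply_eq hpq hij
    exact ⟨h.secondMoment_perm σ p q p q, h.secondMoment_perm σ p p q q⟩
  by_cases h₁ : i = k ∧ j = l
  · obtain ⟨rfl, rfl⟩ := h₁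
    by_cases hij : i = j
    · subst hij
      obtain ⟨j, hj⟩ := exists_ne i
      simp [h.secondMoment_diag hG hj.symm, hoff hj.symm]
    · simp [hij, hoff hij]
  · by_cases h₂ : i = j ∧ k = l
    · obtain ⟨rfl, rfl⟩ := h₂
      have hik : i ≠ k := fun e => h₁ ⟨e, e⟩
      simp [hik, hoff hik]
    · rw [h.secondMoment_eq_zero h₁ h₂, if_neg h₁, if_neg h₂, add_zero]

/-- Variance of linear functionals of a traceless random matrix with invariant second moments and
constant Hilbert–Schmidt norm. -/
theorem InvariantSecondMoments.integral_norm_sq_le [IsProbabilityMeasure μ]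
    (h : InvariantSecondMoments μ G)
    (hG : ∀ i j k l, Integrable (fun x => G x i j * star (G x k l)) μ)
    (htr : ∀ x, (G x).trace = 0) {s : ℝ} (hs : ∀ x, ∑ i, ∑ j, ‖G x i j‖ ^ 2 = s)
    (X : Matrix ι ι ℂ) :
    ∫ x, ‖∑ i, ∑ j, X i j * G x i j‖ ^ 2 ∂μ ≤
      2 * s / (Fintype.card ι : ℝ) ^ 2 * ∑ i, ∑ j, ‖X i j‖ ^ 2 := by
  have hs0 : 0 ≤ s := by
    obtain ⟨x⟩ : Nonempty Ω := μ.nonempty_of_neZero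
    rw [← hs x]; positivity
  -- In dimension one a traceless matrix is zero; from dimension two on, `d² - 1` is positive.
  rcases subsingleton_or_nontrivial ι with hι | hι
  · have h0 : ∀ x, ‖∑ i, ∑ j, X i j * G x i j‖ ^ 2 = 0 := by
      intro x
      have : G x = 0 := by
        ext i j
        have := htr x
        rw [Matrix.trace, Fintype.sum_subsingleton _ i] at this
        simpa [Subsingleton.elim j i] using this
      simp [this]
    simp only [h0, integral_zero]
    positivity
  obtain ⟨a, c, hac⟩ := h.exists_secondMoment_eq hG
  have sq : ∀ z : ℂ, z * star z = ((‖z‖ ^ 2 : ℝ) : ℂ) := fun z => by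
    rw [Complex.star_def, Complex.mul_conj, Complex.normSq_eq_norm_sq]
  have hd : (2 : ℝ) ≤ Fintype.card ι := by exact_mod_cast Fintype.one_lt_card (α := ι)
  have key : ∀ X : Matrix ι ι ℂ, ((∫ x, ‖∑ i, ∑ j, X i j * G x i j‖ ^ 2 ∂μ : ℝ) : ℂ) =
      a * ((∑ i, ∑ j, ‖X i j‖ ^ 2 : ℝ) : ℂ) + c * ((‖X.trace‖ ^ 2 : ℝ) : ℂ) := by
    intro X
    have e := integral_sum_mul_star_sum (S := ι × ι) hG (fun s => X s.1 s.2) Prod.fst Prod.snd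
    simp only [sq, Fintype.sum_prod_type, hac] at e
    rw [← integral_complex_ofReal]
    refine Eq.trans ?_ (e.trans ?_)
    · rfl
    simp only [mul_add, Finset.sum_add_distrib, ite_and, mul_ite, mul_zero, Finset.sum_ite_eq,
      Finset.sum_ite_irrel, Finset.sum_const_zero, Finset.mem_univ, if_true]
    congr 1
    · push_cast
      simp_rw [Finset.mul_sum]
      refine Finset.sum_congr rfl fun i _ => Finset.sum_congr rfl fun j _ => ?_
      rw [sq]
      push_cast
      ring
    · rw [← sq, Matrix.trace, star_sum, Finset.sum_mul_sum, Finset.mul_sum]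
      refine Finset.sum_congr rfl fun i _ => ?_
      rw [Finset.mul_sum]
      refine Finset.sum_congr rfl fun j _ => ?_
      simp only [Matrix.diag_apply]
      ring
  set d : ℝ := (Fintype.card ι : ℝ) with hd_def
  -- Two equations determine `a` and `c`: testing against `X = 1` uses tracelessness, and summing
  -- all `E |G_ij|²` uses the constant norm.
  have h₁ : a * d + c * d ^ 2 = 0 := by
    have e := key 1
    have e₁ : ∀ x, ∑ i, ∑ j, (1 : Matrix ι ι ℂ) i j * G x i j = 0 := fun x => by
      simpa [Matrix.one_apply, Matrix.trace] using htr x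
    have e₂ : ∑ i, ∑ j, ‖(1 : Matrix ι ι ℂ) i j‖ ^ 2 = d := by
      simp [Matrix.one_apply, apply_ite norm, ite_pow, hd_def]
    simp only [e₁, e₂, Matrix.trace_one, norm_zero] at e
    simp [hd_def] at e ⊢
    exact e.symm
  have h₂ : a * d ^ 2 + c * d = s := by
    have e : ∑ i, ∑ j, secondMoment μ G i j i j = s := by
      unfold secondMoment
      simp_rw [← integral_finsetSum Finset.univ fun j _ => hG _ j _ j]
      rw [← integral_finsetSum _ fun i _ => integrable_finsetSum _ fun j _ => hG _ _ _ _]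
      have e' : ∀ x, ∑ i, ∑ j, G x i j * star (G x i j) = s := fun x => by
        simp only [sq]
        exact_mod_cast hs x
      rw [integral_congr_ae (Filter.Eventually.of_forall e')]
      simp
    rw [← e]
    simp only [hac, and_self, if_true, Finset.sum_add_distrib, Finset.sum_ite_eq, Finset.mem_univ]
    simp [hd_def]
    ring
  have hd0 : (d : ℂ) ≠ 0 := by exact_mod_cast (by linarith : d ≠ 0)
  have hd1 : 0 < d ^ 2 - 1 := by nlinarith
  have hd1' : ((d ^ 2 - 1 : ℝ) : ℂ) ≠ 0 := by exact_mod_cast hd1.ne'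
  have hc : c = -a / d := by
    rw [eq_div_iff hd0]
    exact mul_right_cancel₀ hd0 (by linear_combination h₁)
  have ha : a = ((s / (d ^ 2 - 1) : ℝ) : ℂ) := by
    rw [hc, div_mul_cancel₀ _ hd0] at h₂
    rw [Complex.ofReal_div, eq_div_iff hd1', ← h₂]
    push_cast
    ring
  have e := key X
  rw [hc, ha] at e
  have e' : ∫ x, ‖∑ i, ∑ j, X i j * G x i j‖ ^ 2 ∂μ =
      s / (d ^ 2 - 1) * (∑ i, ∑ j, ‖X i j‖ ^ 2) + -(s / (d ^ 2 - 1)) / d * ‖X.trace‖ ^ 2 := by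
    exact_mod_cast e
  -- Since `c = -a / d ≤ 0`, the trace term can be dropped; `d ≥ 2` then gives `1 / (d² - 1) ≤ 2 /
  -- d²`.
  have hneg : -(s / (d ^ 2 - 1)) / d * ‖X.trace‖ ^ 2 ≤ 0 := by
    refine mul_nonpos_of_nonpos_of_nonneg (div_nonpos_of_nonpos_of_nonneg ?_ (by linarith))
      (by positivity)
    exact neg_nonpos.2 (div_nonneg hs0 hd1.le)
  have hle : s / (d ^ 2 - 1) ≤ 2 * s / d ^ 2 := by
    rw [div_le_div_iff₀ hd1 (by positivity)]
    nlinarith [mul_nonneg hs0 (by nlinarith : (0 : ℝ) ≤ d ^ 2 - 2)]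
  rw [e']
  have := mul_le_mul_of_nonneg_right hle
    (by positivity : (0 : ℝ) ≤ ∑ i, ∑ j, ‖X i j‖ ^ 2)
  linarith

end Moments

/-! ### Averages over a unitary design -/

/-- The squared Hilbert–Schmidt norm. -/
noncomputable def hsNormSq {m n : Type*} [Fintype m] [Fintype n] (M : Matrix m n ℂ) : ℝ :=
  ∑ i, ∑ j, ‖M i j‖ ^ 2

theorem hsNormSq_nonneg {m n : Type*} [Fintype m] [Fintype n] (M : Matrix m n ℂ) :
    0 ≤ hsNormSq M := by
  unfold hsNormSq; positivity

theorem hsNormSq_eq_trace {m n : Type*} [Fintype m] [Fintype n] (M : Matrix m n ℂ) :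
    (hsNormSq M : ℂ) = (M * Mᴴ).trace := by
  simp [hsNormSq, Matrix.trace, Matrix.mul_apply, Complex.mul_conj, Complex.normSq_eq_norm_sq]

theorem mul_mul_apply_eq_sum {ι : Type*} [Fintype ι] (L K M : Matrix ι ι ℂ) (i j : ι) :
    (L * K * M) i j = ∑ s : ι × ι, K s.1 s.2 * (L i s.1 * M s.2 j) := by
  rw [Fintype.sum_prod_type_right]
  simp only [Matrix.mul_apply, Finset.sum_mul]
  refine Finset.sum_congr rfl fun a _ => Finset.sum_congr rfl fun b _ => ?_
  ring

section Design

variable {ι : Type*} [Fintype ι] [DecidableEq ι]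

theorem conjTranspose_mul_self_of_unitary (V : Matrix.unitaryGroup ι ℂ) : V.1ᴴ * V.1 = 1 :=
  Matrix.mem_unitaryGroup_iff'.1 V.2

theorem mul_conjTranspose_self_of_unitary (V : Matrix.unitaryGroup ι ℂ) : V.1 * V.1ᴴ = 1 :=
  Matrix.mem_unitaryGroup_iff.1 V.2

theorem trace_unitary_conj (V : Matrix.unitaryGroup ι ℂ) (K : Matrix ι ι ℂ) :
    (V.1 * K * V.1ᴴ).trace = K.trace := by
  rw [Matrix.trace_mul_comm, ← mul_assoc, conjTranspose_mul_self_of_unitary, one_mul]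

theorem trace_unitary_conj' (V : Matrix.unitaryGroup ι ℂ) (K : Matrix ι ι ℂ) :
    (V.1ᴴ * K * V.1).trace = K.trace := by
  simpa using trace_unitary_conj ⟨V.1ᴴ, (V⁻¹).2⟩ K

theorem hsNormSq_unitary_conj (V : Matrix.unitaryGroup ι ℂ) (K : Matrix ι ι ℂ) :
    hsNormSq (V.1 * K * V.1ᴴ) = hsNormSq K := by
  have : V.1 * K * V.1ᴴ * (V.1 * K * V.1ᴴ)ᴴ = V.1 * (K * Kᴴ) * V.1ᴴ := by
    simp only [Matrix.conjTranspose_mul, Matrix.conjTranspose_conjTranspose, mul_assoc]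
    rw [← mul_assoc V.1ᴴ V.1, conjTranspose_mul_self_of_unitary, one_mul]
  have h : (hsNormSq (V.1 * K * V.1ᴴ) : ℂ) = hsNormSq K := by
    rw [hsNormSq_eq_trace, hsNormSq_eq_trace, this, trace_unitary_conj]
  exact_mod_cast h

theorem hsNormSq_unitary_conj' (V : Matrix.unitaryGroup ι ℂ) (K : Matrix ι ι ℂ) :
    hsNormSq (V.1ᴴ * K * V.1) = hsNormSq K := by
  simpa using hsNormSq_unitary_conj ⟨V.1ᴴ, (V⁻¹).2⟩ K

theorem continuous_unitary_conj (K : Matrix ι ι ℂ) :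
    Continuous fun V : Matrix.unitaryGroup ι ℂ => V.1 * K * V.1ᴴ :=
  (continuous_subtype_val.matrix_mul continuous_const).matrix_mul
    continuous_subtype_val.matrix_conjTranspose

theorem continuous_unitary_conj' (K : Matrix ι ι ℂ) :
    Continuous fun V : Matrix.unitaryGroup ι ℂ => V.1ᴴ * K * V.1 :=
  (continuous_subtype_val.matrix_conjTranspose.matrix_mul continuous_const).matrix_mul
    continuous_subtype_val

theorem integrable_entry_mul_star_entry {ν : Measure (Matrix.unitaryGroup ι ℂ)} [IsFiniteMeasure ν]
    {G : Matrix.unitaryGroup ι ℂ → Matrix ι ι ℂ} (hG : Continuous G) (i j k l : ι) :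
    Integrable (fun V => G V i j * star (G V k l)) ν :=
  integrable_of_continuous ((hG.matrix_elem i j).mul (hG.matrix_elem k l).star)

theorem invariantSecondMoments_unitary_conj (K : Matrix ι ι ℂ) :
    InvariantSecondMoments (haarUnitary ι) fun V => V.1 * K * V.1ᴴ := by
  intro W hW i j k l
  have := integral_mul_left_eq_self (μ := haarUnitary ι)
    (fun V => (V.1 * K * V.1ᴴ) i j * star ((V.1 * K * V.1ᴴ) k l)) ⟨W, hW⟩
  simp only [Submonoid.coe_mul, Matrix.conjTranspose_mul] at this
  simpa only [secondMoment, mul_assoc] using this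

/-- Here `W Vᴴ K V Wᴴ` is the same expression at `V W⁻¹`, so right invariance applies. -/
theorem invariantSecondMoments_unitary_conj' (K : Matrix ι ι ℂ) :
    InvariantSecondMoments (haarUnitary ι) fun V => V.1ᴴ * K * V.1 := by
  intro W hW i j k l
  have := integral_mul_right_eq_self (μ := haarUnitary ι)
    (fun V => (V.1ᴴ * K * V.1) i j * star ((V.1ᴴ * K * V.1) k l)) ⟨W, hW⟩⁻¹
  simp only [Submonoid.coe_mul, Matrix.conjTranspose_mul] at this
  simpa [secondMoment, mul_assoc, Matrix.star_eq_conjTranspose] using this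

/-! ### Transfer of second moments from Haar measure to a 2-design. -/

theorem IsUnitaryDesign.integral_entries {ν : Measure (Matrix.unitaryGroup ι ℂ)}
    (hν : IsUnitaryDesign 2 ν) (a b c d : ι × ι) :
    ∫ V, V.1 a.1 a.2 * V.1 b.1 b.2 * V.1ᴴ c.1 c.2 * V.1ᴴ d.1 d.2 ∂ν =
      ∫ V, V.1 a.1 a.2 * V.1 b.1 b.2 * V.1ᴴ c.1 c.2 * V.1ᴴ d.1 d.2 ∂(haarUnitary ι) := by
  have h := hν (MvPolynomial.monomial (Finsupp.single (Sum.inl a) 1 + Finsupp.single (Sum.inl b) 1 +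
    Finsupp.single (Sum.inr c) 1 + Finsupp.single (Sum.inr d) 1) 1) ?_
  · simpa only [evalAt, MvPolynomial.monomial_add_single, pow_one, map_mul,
      MvPolynomial.eval_X, ← MvPolynomial.X_pow_eq_monomial, Sum.elim_inl, Sum.elim_inr] using h
  · intro s hs
    obtain rfl := Finset.mem_singleton.1 (MvPolynomial.support_monomial_subset hs)
    simp [Finsupp.single_apply, Finset.sum_add_distrib]

theorem IsUnitaryDesign.integral_sum_entries {ν : Measure (Matrix.unitaryGroup ι ℂ)}
    [IsFiniteMeasure ν] (hν : IsUnitaryDesign 2 ν) {S : Type*} [Fintype S] (z : S → ℂ)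
    (a b c d : S → ι × ι) :
    ∫ V, ∑ s, z s * (V.1 (a s).1 (a s).2 * V.1 (b s).1 (b s).2 * V.1ᴴ (c s).1 (c s).2 *
        V.1ᴴ (d s).1 (d s).2) ∂ν =
      ∫ V, ∑ s, z s * (V.1 (a s).1 (a s).2 * V.1 (b s).1 (b s).2 * V.1ᴴ (c s).1 (c s).2 *
        V.1ᴴ (d s).1 (d s).2) ∂(haarUnitary ι) := by
  have hc : ∀ s, Continuous fun V : Matrix.unitaryGroup ι ℂ =>
      z s * (V.1 (a s).1 (a s).2 * V.1 (b s).1 (b s).2 * V.1ᴴ (c s).1 (c s).2 *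
        V.1ᴴ (d s).1 (d s).2) := fun s =>
    continuous_const.mul ((((continuous_subtype_val.matrix_elem _ _).mul
      (continuous_subtype_val.matrix_elem _ _)).mul
      (continuous_subtype_val.matrix_conjTranspose.matrix_elem _ _)).mul
      (continuous_subtype_val.matrix_conjTranspose.matrix_elem _ _))
  rw [integral_finsetSum _ fun s _ => integrable_of_continuous (hc s),
    integral_finsetSum _ fun s _ => integrable_of_continuous (hc s)]
  refine Finset.sum_congr rfl fun s _ => ?_
  rw [integral_const_mul, integral_const_mul, hν.integral_entries]

/-- Conjugates of entries of `V` are entries of `Vᴴ`, so the integrand is a polynomial of bidegree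
`(2, 2)`. -/
theorem IsUnitaryDesign.secondMoment_unitary_conj {ν : Measure (Matrix.unitaryGroup ι ℂ)}
    [IsFiniteMeasure ν] (hν : IsUnitaryDesign 2 ν) (K : Matrix ι ι ℂ) (i j k l : ι) :
    secondMoment ν (fun V => V.1 * K * V.1ᴴ) i j k l =
      secondMoment (haarUnitary ι) (fun V => V.1 * K * V.1ᴴ) i j k l := by
  have e : ∀ V : Matrix.unitaryGroup ι ℂ,
      (V.1 * K * V.1ᴴ) i j * star ((V.1 * K * V.1ᴴ) k l) =
        ∑ s : (ι × ι) × (ι × ι), K s.1.1 s.1.2 * star (K s.2.1 s.2.2) *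
          (V.1 i s.1.1 * V.1 l s.2.2 * V.1ᴴ s.1.2 j * V.1ᴴ s.2.1 k) := by
    intro V
    rw [mul_mul_apply_eq_sum, mul_mul_apply_eq_sum, star_sum, Finset.sum_mul_sum]
    refine Eq.trans ?_ (Fintype.sum_prod_type _).symm
    refine Finset.sum_congr rfl fun a _ => Finset.sum_congr rfl fun b _ => ?_
    simp only [Matrix.conjTranspose_apply, star_mul', star_star]
    ring
  simp only [secondMoment, e]
  exact hν.integral_sum_entries (S := (ι × ι) × (ι × ι))
    (fun s => K s.1.1 s.1.2 * star (K s.2.1 s.2.2)) (fun s => (i, s.1.1)) (fun s => (l, s.2.2))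
    (fun s => (s.1.2, j)) (fun s => (s.2.1, k))

theorem IsUnitaryDesign.secondMoment_unitary_conj' {ν : Measure (Matrix.unitaryGroup ι ℂ)}
    [IsFiniteMeasure ν] (hν : IsUnitaryDesign 2 ν) (K : Matrix ι ι ℂ) (i j k l : ι) :
    secondMoment ν (fun V => V.1ᴴ * K * V.1) i j k l =
      secondMoment (haarUnitary ι) (fun V => V.1ᴴ * K * V.1) i j k l := by
  have e : ∀ V : Matrix.unitaryGroup ι ℂ,
      (V.1ᴴ * K * V.1) i j * star ((V.1ᴴ * K * V.1) k l) =
        ∑ s : (ι × ι) × (ι × ι), K s.1.1 s.1.2 * star (K s.2.1 s.2.2) *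
          (V.1 s.1.2 j * V.1 s.2.1 k * V.1ᴴ i s.1.1 * V.1ᴴ l s.2.2) := by
    intro V
    rw [mul_mul_apply_eq_sum, mul_mul_apply_eq_sum, star_sum, Finset.sum_mul_sum]
    refine Eq.trans ?_ (Fintype.sum_prod_type _).symm
    refine Finset.sum_congr rfl fun a _ => Finset.sum_congr rfl fun b _ => ?_
    simp only [Matrix.conjTranspose_apply, star_mul', star_star]
    ring
  simp only [secondMoment, e]
  exact hν.integral_sum_entries (S := (ι × ι) × (ι × ι))
    (fun s => K s.1.1 s.1.2 * star (K s.2.1 s.2.2)) (fun s => (s.1.2, j)) (fun s => (s.2.1, k))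
    (fun s => (i, s.1.1)) (fun s => (l, s.2.2))

theorem integral_norm_sq_eq_of_secondMoment_eq {ν ν' : Measure (Matrix.unitaryGroup ι ℂ)}
    [IsFiniteMeasure ν] [IsFiniteMeasure ν'] {G : Matrix.unitaryGroup ι ℂ → Matrix ι ι ℂ}
    (hG : Continuous G) (h : ∀ i j k l, secondMoment ν G i j k l = secondMoment ν' G i j k l)
    (X : Matrix ι ι ℂ) :
    ∫ V, ‖∑ i, ∑ j, X i j * G V i j‖ ^ 2 ∂ν = ∫ V, ‖∑ i, ∑ j, X i j * G V i j‖ ^ 2 ∂ν' := by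
  have e : ∀ (η : Measure (Matrix.unitaryGroup ι ℂ)) [IsFiniteMeasure η],
      ((∫ V, ‖∑ i, ∑ j, X i j * G V i j‖ ^ 2 ∂η : ℝ) : ℂ) =
        ∑ s : ι × ι, ∑ t : ι × ι, X s.1 s.2 * star (X t.1 t.2) *
          secondMoment η G s.1 s.2 t.1 t.2 := by
    intro η _
    rw [← integral_sum_mul_star_sum (integrable_entry_mul_star_entry hG), ← integral_complex_ofReal]
    congr 1
    funext V
    rw [Complex.star_def, Complex.mul_conj, Complex.normSq_eq_norm_sq, Fintype.sum_prod_type]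
  have := (e ν).trans (Eq.trans (by simp only [h]) (e ν').symm)
  exact_mod_cast this

theorem IsUnitaryDesign.integral_norm_sq_le {ν : Measure (Matrix.unitaryGroup ι ℂ)}
    [IsFiniteMeasure ν] (hν : IsUnitaryDesign 2 ν) {K : Matrix ι ι ℂ} (hK : K.trace = 0)
    (X : Matrix ι ι ℂ) :
    ∫ V, ‖∑ i, ∑ j, X i j * (V.1 * K * V.1ᴴ) i j‖ ^ 2 ∂ν ≤
      2 * hsNormSq K / (Fintype.card ι : ℝ) ^ 2 * hsNormSq X := by
  rw [integral_norm_sq_eq_of_secondMoment_eq (continuous_unitary_conj K)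
    (hν.secondMoment_unitary_conj K)]
  exact (invariantSecondMoments_unitary_conj K).integral_norm_sq_le
    (integrable_entry_mul_star_entry (continuous_unitary_conj K))
    (fun V => by rw [trace_unitary_conj, hK]) (fun V => hsNormSq_unitary_conj V K) X

theorem IsUnitaryDesign.integral_norm_sq_le' {ν : Measure (Matrix.unitaryGroup ι ℂ)}
    [IsFiniteMeasure ν] (hν : IsUnitaryDesign 2 ν) {K : Matrix ι ι ℂ} (hK : K.trace = 0)
    (X : Matrix ι ι ℂ) :
    ∫ V, ‖∑ i, ∑ j, X i j * (V.1ᴴ * K * V.1) i j‖ ^ 2 ∂ν ≤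
      2 * hsNormSq K / (Fintype.card ι : ℝ) ^ 2 * hsNormSq X := by
  rw [integral_norm_sq_eq_of_secondMoment_eq (continuous_unitary_conj' K)
    (hν.secondMoment_unitary_conj' K)]
  exact (invariantSecondMoments_unitary_conj' K).integral_norm_sq_le
    (integrable_entry_mul_star_entry (continuous_unitary_conj' K))
    (fun V => by rw [trace_unitary_conj', hK]) (fun V => hsNormSq_unitary_conj' V K) X

end Design

/-! ### Hilbert–Schmidt norms and spectra -/

section Spectral

open scoped ComplexOrder

variable {ι : Type*} [Fintype ι] [DecidableEq ι]

/-- Pythagoras: traceless matrices are Hilbert–Schmidt orthogonal to the identity. -/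
theorem hsNormSq_le_hsNormSq_add_smul_one {K : Matrix ι ι ℂ} (hK : K.trace = 0) (y : ℂ) :
    hsNormSq K ≤ hsNormSq (K + y • (1 : Matrix ι ι ℂ)) := by
  have h : (hsNormSq (K + y • (1 : Matrix ι ι ℂ)) : ℂ) =
      ((hsNormSq K + ‖y‖ ^ 2 * Fintype.card ι : ℝ) : ℂ) := by
    push_cast
    rw [hsNormSq_eq_trace, hsNormSq_eq_trace, ← Complex.ofReal_pow, ← Complex.normSq_eq_norm_sq,
      ← Complex.mul_conj]
    simp [add_mul, mul_add, hK, Matrix.trace_conjTranspose]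
    ring
  have h' : hsNormSq (K + y • (1 : Matrix ι ι ℂ)) = hsNormSq K + ‖y‖ ^ 2 * Fintype.card ι := by
    exact_mod_cast h
  rw [h']
  have : 0 ≤ ‖y‖ ^ 2 * (Fintype.card ι : ℝ) := by positivity
  linarith

theorem trace_sub_trace_div_card [Nonempty ι] (M : Matrix ι ι ℂ) :
    (M - (M.trace / Fintype.card ι) • (1 : Matrix ι ι ℂ)).trace = 0 := by
  simp

theorem hsNormSq_sub_trace_le [Nonempty ι] (M : Matrix ι ι ℂ) (z : ℂ) :
    hsNormSq (M - (M.trace / Fintype.card ι) • (1 : Matrix ι ι ℂ)) ≤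
      hsNormSq (M - z • (1 : Matrix ι ι ℂ)) := by
  refine (hsNormSq_le_hsNormSq_add_smul_one (trace_sub_trace_div_card M)
    (M.trace / Fintype.card ι - z)).trans_eq ?_
  congr 1
  module

theorem hsNormSq_diagonal (D : ι → ℂ) : hsNormSq (Matrix.diagonal D) = ∑ i, ‖D i‖ ^ 2 := by
  simp [hsNormSq, Matrix.diagonal_apply, apply_ite norm, ite_pow]

theorem eq_unitary_conj_diagonal {H : Matrix ι ι ℂ} (hH : H.IsHermitian) :
    H = hH.eigenvectorUnitary.1 * Matrix.diagonal (fun i => (hH.eigenvalues i : ℂ)) *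
      hH.eigenvectorUnitary.1ᴴ := by
  conv_lhs => rw [hH.spectral_theorem, Unitary.conjStarAlgAut_apply]
  rfl

theorem hsNormSq_sub_smul_one {H : Matrix ι ι ℂ} (hH : H.IsHermitian) (c : ℝ) :
    hsNormSq (H - (c : ℂ) • (1 : Matrix ι ι ℂ)) = ∑ i, (hH.eigenvalues i - c) ^ 2 := by
  have e : H - (c : ℂ) • (1 : Matrix ι ι ℂ) = hH.eigenvectorUnitary.1 *
      Matrix.diagonal (fun i => ((hH.eigenvalues i - c : ℝ) : ℂ)) *
      hH.eigenvectorUnitary.1ᴴ := by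
    have : Matrix.diagonal (fun i => ((hH.eigenvalues i - c : ℝ) : ℂ)) =
        Matrix.diagonal (fun i => (hH.eigenvalues i : ℂ)) - (c : ℂ) • (1 : Matrix ι ι ℂ) := by
      ext i j
      by_cases hij : i = j <;> simp [hij]
    rw [this, mul_sub, sub_mul, ← eq_unitary_conj_diagonal hH, mul_smul_comm, smul_mul_assoc,
      mul_one, mul_conjTranspose_self_of_unitary]
  rw [e, hsNormSq_unitary_conj, hsNormSq_diagonal]
  simp [-Complex.ofReal_sub]

theorem sInf_spectrum_le_eigenvalues {H : Matrix ι ι ℂ} (hH : H.IsHermitian) (i : ι) :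
    sInf (spectrum ℝ H) ≤ hH.eigenvalues i := by
  rw [hH.spectrum_real_eq_range_eigenvalues]
  exact csInf_le (Set.finite_range _).bddBelow (Set.mem_range_self i)

theorem eigenvalues_le_sSup_spectrum {H : Matrix ι ι ℂ} (hH : H.IsHermitian) (i : ι) :
    hH.eigenvalues i ≤ sSup (spectrum ℝ H) := by
  rw [hH.spectrum_real_eq_range_eigenvalues]
  exact le_csSup (Set.finite_range _).bddAbove (Set.mem_range_self i)

/-- Every eigenvalue lies within `w / 2` of the midpoint of the spectrum. -/
theorem hsNormSq_sub_midpoint_le {H : Matrix ι ι ℂ} (hH : H.IsHermitian) :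
    hsNormSq (H - (((sInf (spectrum ℝ H) + sSup (spectrum ℝ H)) / 2 : ℝ) : ℂ) •
      (1 : Matrix ι ι ℂ)) ≤ Fintype.card ι * (spectralWidth H ^ 2 / 4) := by
  rw [hsNormSq_sub_smul_one hH, ← nsmul_eq_mul, ← Finset.card_univ]
  refine Finset.sum_le_card_nsmul _ _ _ fun i _ => ?_
  have h₁ := sInf_spectrum_le_eigenvalues hH i
  have h₂ := eigenvalues_le_sSup_spectrum hH i
  unfold spectralWidth
  nlinarith

theorem IsDensityMatrix.hsNormSq_le_one {ρ : Matrix ι ι ℂ} (hρ : IsDensityMatrix ρ) :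
    hsNormSq ρ ≤ 1 := by
  obtain ⟨hpos, htr⟩ := hρ
  have h := hsNormSq_sub_smul_one hpos.isHermitian 0
  simp only [Complex.ofReal_zero, zero_smul, sub_zero] at h
  have ht : ∑ i, hpos.isHermitian.eigenvalues i = 1 := by
    have := htr.symm.trans hpos.isHermitian.trace_eq_sum_eigenvalues
    simpa using congrArg Complex.re this.symm
  rw [h]
  refine (Finset.sum_sq_le_sq_sum_of_nonneg fun i _ => hpos.eigenvalues_nonneg i).trans_eq ?_
  rw [ht, one_pow]

theorem IsDensityMatrix.unitary_conj {ρ : Matrix ι ι ℂ} (hρ : IsDensityMatrix ρ)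
    (V : Matrix.unitaryGroup ι ℂ) : IsDensityMatrix (V.1 * ρ * V.1ᴴ) :=
  ⟨hρ.1.mul_mul_conjTranspose_same _, by rw [trace_unitary_conj, hρ.2]⟩

/-- In an eigenbasis of `H` the diagonal of the state is a probability vector, so the trace is a
convex combination of eigenvalues. -/
theorem IsDensityMatrix.trace_mul_mem_Icc {H ρ : Matrix ι ι ℂ} (hρ : IsDensityMatrix ρ)
    (hH : H.IsHermitian) :
    (H * ρ).trace.re ∈ Set.Icc (sInf (spectrum ℝ H)) (sSup (spectrum ℝ H)) := by
  set W := hH.eigenvectorUnitary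
  set σ := W.1ᴴ * ρ * W.1 with hσ_def
  have hσ : IsDensityMatrix σ :=
    ⟨hρ.1.conjTranspose_mul_mul_same _, by rw [hσ_def, trace_unitary_conj', hρ.2]⟩
  have e : (H * ρ).trace.re = ∑ i, hH.eigenvalues i * (σ i i).re := by
    have : (H * ρ).trace = (Matrix.diagonal (fun i => (hH.eigenvalues i : ℂ)) * σ).trace := by
      conv_lhs => rw [eq_unitary_conj_diagonal hH]
      rw [hσ_def, mul_assoc, mul_assoc, Matrix.trace_mul_comm, mul_assoc]
    rw [this, Matrix.trace, Complex.re_sum]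
    simp
  have h0 : ∀ i, 0 ≤ (σ i i).re := fun i => (Complex.le_def.1 hσ.1.diag_nonneg).1
  have h1 : ∑ i, (σ i i).re = 1 := by
    have := congrArg Complex.re hσ.2
    simpa [Matrix.trace] using this
  rw [e]
  constructor
  · calc _ = ∑ i, sInf (spectrum ℝ H) * (σ i i).re := by rw [← Finset.mul_sum, h1, mul_one]
      _ ≤ _ := Finset.sum_le_sum fun i _ =>
        mul_le_mul_of_nonneg_right (sInf_spectrum_le_eigenvalues hH i) (h0 i)
  · calc _ ≤ ∑ i, sSup (spectrum ℝ H) * (σ i i).re := Finset.sum_le_sum fun i _ =>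
        mul_le_mul_of_nonneg_right (eigenvalues_le_sSup_spectrum hH i) (h0 i)
      _ = _ := by rw [← Finset.mul_sum, h1, mul_one]

end Spectral

/-! ### The quadratic form of a local unitary -/

section Block

variable {A B : Type*} [Fintype A] [Fintype B]

/-- The coefficient of `U i j * conj (U k l)` in `tr (P (U ⊗ 1) Q (U ⊗ 1)ᴴ)`, for `s = (i, j)` and
`t = (k, l)`. -/
def blockCoeff (P Q : Matrix (A × B) (A × B) ℂ) (s t : A × A) : ℂ :=
  ∑ b, ∑ b', P (t.1, b') (s.1, b) * Q (s.2, b) (t.2, b')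

theorem trace_mul_kronecker_one [DecidableEq B] (P Q : Matrix (A × B) (A × B) ℂ)
    (U : Matrix A A ℂ) :
    (P * (U ⊗ₖ (1 : Matrix B B ℂ)) * Q * (U ⊗ₖ (1 : Matrix B B ℂ))ᴴ).trace =
      ∑ s : A × A, ∑ t : A × A, U s.1 s.2 * star (U t.1 t.2) * blockCoeff P Q s t := by
  have hL : (P * (U ⊗ₖ (1 : Matrix B B ℂ)) * Q * (U ⊗ₖ (1 : Matrix B B ℂ))ᴴ).trace =
      ∑ p : A × B × A × A × B × A, P (p.1, p.2.1) (p.2.2.2.2.2, p.2.2.2.2.1) *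
        U p.2.2.2.2.2 p.2.2.2.1 * Q (p.2.2.2.1, p.2.2.2.2.1) (p.2.2.1, p.2.1) *
        star (U p.1 p.2.2.1) := by
    simp [Matrix.trace, Matrix.mul_apply, Fintype.sum_prod_type, Matrix.one_apply, Finset.sum_mul,
      apply_ite (starRingEnd ℂ)]
  have hR : ∑ s : A × A, ∑ t : A × A, U s.1 s.2 * star (U t.1 t.2) * blockCoeff P Q s t =
      ∑ p : A × A × A × A × B × B, P (p.2.2.1, p.2.2.2.2.2) (p.1, p.2.2.2.2.1) *
        U p.1 p.2.1 * Q (p.2.1, p.2.2.2.2.1) (p.2.2.2.1, p.2.2.2.2.2) *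
        star (U p.2.2.1 p.2.2.2.1) := by
    simp only [blockCoeff, Fintype.sum_prod_type, Finset.mul_sum]
    refine Finset.sum_congr rfl fun i _ => Finset.sum_congr rfl fun j _ =>
      Finset.sum_congr rfl fun k _ => Finset.sum_congr rfl fun l _ =>
      Finset.sum_congr rfl fun b _ => Finset.sum_congr rfl fun b' _ => ?_
    ring
  rw [hL, hR]
  -- Reorders the summation indices `(k, b', l, j, b, i)` as `(i, j, k, l, b, b')`.
  let e : A × B × A × A × B × A ≃ A × A × A × A × B × B :=
    { toFun := fun p => (p.2.2.2.2.2, p.2.2.2.1, p.1, p.2.2.1, p.2.2.2.2.1, p.2.1)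
      invFun := fun p => (p.2.2.1, p.2.2.2.2.2, p.2.2.2.1, p.2.1, p.2.2.2.2.1, p.1)
      left_inv := fun _ => rfl
      right_inv := fun _ => rfl }
  exact Fintype.sum_equiv e _ _ fun p => rfl

theorem hsNormSq_unitary [DecidableEq A] (U : Matrix.unitaryGroup A ℂ) :
    hsNormSq U.1 = Fintype.card A := by
  have h : (hsNormSq U.1 : ℂ) = (Fintype.card A : ℝ) := by
    rw [hsNormSq_eq_trace, mul_conjTranspose_self_of_unitary, Matrix.trace_one]
    simp
  exact_mod_cast h

theorem norm_trace_sq_le [DecidableEq A] [DecidableEq B] (P Q : Matrix (A × B) (A × B) ℂ)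
    (U : Matrix.unitaryGroup A ℂ) :
    ‖(P * (U.1 ⊗ₖ (1 : Matrix B B ℂ)) * Q * (U.1 ⊗ₖ (1 : Matrix B B ℂ))ᴴ).trace‖ ^ 2 ≤
      (Fintype.card A : ℝ) ^ 2 * ∑ s, ∑ t, ‖blockCoeff P Q s t‖ ^ 2 := by
  rw [trace_mul_kronecker_one]
  have h₁ : ‖∑ s : A × A, ∑ t : A × A, U.1 s.1 s.2 * star (U.1 t.1 t.2) * blockCoeff P Q s t‖ ≤
      ∑ p : (A × A) × (A × A), (‖U.1 p.1.1 p.1.2‖ * ‖U.1 p.2.1 p.2.2‖) *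
        ‖blockCoeff P Q p.1 p.2‖ := by
    rw [← Fintype.sum_prod_type']
    refine (norm_sum_le _ _).trans_eq (Finset.sum_congr rfl fun p _ => ?_)
    simp
  refine (pow_le_pow_left₀ (norm_nonneg _) h₁ 2).trans ?_
  refine (Finset.sum_mul_sq_le_sq_mul_sq _ _ _).trans_eq ?_
  rw [← Fintype.sum_prod_type' (f := fun s t => ‖blockCoeff P Q s t‖ ^ 2)]
  congr 1
  have h := hsNormSq_unitary U
  rw [hsNormSq, ← Fintype.sum_prod_type' (f := fun i j => ‖U.1 i j‖ ^ 2)] at h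
  rw [← h, sq, Finset.sum_mul_sum, ← Fintype.sum_prod_type']
  exact Finset.sum_congr rfl fun p _ => mul_pow _ _ _

/-- Cyclicity of the trace exchanges `P` and `Q` while replacing `U` by `Uᴴ`. This puts the averaged
matrix in the second slot when `V₂` is the design. -/
theorem norm_trace_sq_le' [DecidableEq A] [DecidableEq B] (P Q : Matrix (A × B) (A × B) ℂ)
    (U : Matrix.unitaryGroup A ℂ) :
    ‖(P * (U.1 ⊗ₖ (1 : Matrix B B ℂ)) * Q * (U.1 ⊗ₖ (1 : Matrix B B ℂ))ᴴ).trace‖ ^ 2 ≤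
      (Fintype.card A : ℝ) ^ 2 * ∑ s, ∑ t, ‖blockCoeff Q P s t‖ ^ 2 := by
  have h := norm_trace_sq_le Q P (⟨U.1ᴴ, (U⁻¹).2⟩ : Matrix.unitaryGroup A ℂ)
  have e : U.1ᴴ ⊗ₖ (1 : Matrix B B ℂ) = (U.1 ⊗ₖ (1 : Matrix B B ℂ))ᴴ := by
    rw [Matrix.conjTranspose_kronecker, Matrix.conjTranspose_one]
  simp only [e, Matrix.conjTranspose_conjTranspose] at h
  rw [mul_assoc, Matrix.trace_mul_comm, ← mul_assoc]
  exact h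

variable [DecidableEq A]

/-- The matrix of the linear functional `Q ↦ blockCoeff P Q s t`. -/
def blockFunctional (P : Matrix (A × B) (A × B) ℂ) (s t : A × A) : Matrix (A × B) (A × B) ℂ :=
  fun z w => if z.1 = s.2 then if w.1 = t.2 then P (t.1, w.2) (s.1, z.2) else 0 else 0

theorem blockCoeff_eq_sum (P Q : Matrix (A × B) (A × B) ℂ) (s t : A × A) :
    blockCoeff P Q s t = ∑ z, ∑ w, blockFunctional P s t z w * Q z w := by
  simp only [blockFunctional, Fintype.sum_prod_type, ite_mul, zero_mul, Finset.sum_ite_irrel,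
    Finset.sum_const_zero]
  simp [blockCoeff]

/-- The entries of `P` are determined by `s.1`, `t.1` and the `B` indices; the free choice of `s.2`,
`t.2` repeats each one `d_A²` times. -/
theorem sum_hsNormSq_blockFunctional (P : Matrix (A × B) (A × B) ℂ) :
    ∑ s, ∑ t, hsNormSq (blockFunctional P s t) = (Fintype.card A : ℝ) ^ 2 * hsNormSq P := by
  have h : ∀ s t : A × A, hsNormSq (blockFunctional P s t) =
      ∑ b, ∑ b', ‖P (t.1, b') (s.1, b)‖ ^ 2 := by
    intro s t
    simp [hsNormSq, blockFunctional, Fintype.sum_prod_type, apply_ite norm, ite_pow,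
      Finset.sum_ite_irrel]
  have hP : hsNormSq P = ∑ i, ∑ k, ∑ b, ∑ b', ‖P (k, b') (i, b)‖ ^ 2 := by
    rw [hsNormSq, Finset.sum_comm, Fintype.sum_prod_type]
    refine Finset.sum_congr rfl fun i _ => ?_
    simp only [Fintype.sum_prod_type]
    rw [Finset.sum_comm]
  simp only [h, hP, Fintype.sum_prod_type, Finset.sum_const, Finset.card_univ, nsmul_eq_mul,
    ← Finset.mul_sum]
  ring

theorem integral_sum_norm_blockCoeff_le {Ω : Type*} [MeasurableSpace Ω] {μ : Measure Ω}
    {G : Ω → Matrix (A × B) (A × B) ℂ} {κ : ℝ}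
    (hG : ∀ X : Matrix (A × B) (A × B) ℂ,
      Integrable (fun x => ‖∑ i, ∑ j, X i j * G x i j‖ ^ 2) μ)
    (h : ∀ X : Matrix (A × B) (A × B) ℂ,
      ∫ x, ‖∑ i, ∑ j, X i j * G x i j‖ ^ 2 ∂μ ≤ κ * hsNormSq X)
    (P : Matrix (A × B) (A × B) ℂ) :
    ∫ x, ∑ s, ∑ t, ‖blockCoeff P (G x) s t‖ ^ 2 ∂μ ≤
      κ * ((Fintype.card A : ℝ) ^ 2 * hsNormSq P) := by
  simp only [blockCoeff_eq_sum]
  rw [integral_finsetSum _ fun s _ => integrable_finsetSum _ fun t _ => hG _,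
    ← sum_hsNormSq_blockFunctional, Finset.mul_sum]
  refine Finset.sum_le_sum fun s _ => ?_
  rw [integral_finsetSum _ fun t _ => hG _, Finset.mul_sum]
  exact Finset.sum_le_sum fun t _ => h _

end Block

/-! ### The variation range -/

theorem continuous_iSup_of_compactSpace {X Y : Type*} [TopologicalSpace X] [TopologicalSpace Y]
    [CompactSpace Y] {F : X → Y → ℝ} (hF : Continuous fun p : X × Y => F p.1 p.2) :
    Continuous fun x => ⨆ y, F x y := by
  have h := (isCompact_univ (X := Y)).continuous_sSup (f := F) hF
  simp only [Set.image_univ] at h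
  exact h

theorem continuous_iInf_of_compactSpace {X Y : Type*} [TopologicalSpace X] [TopologicalSpace Y]
    [CompactSpace Y] {F : X → Y → ℝ} (hF : Continuous fun p : X × Y => F p.1 p.2) :
    Continuous fun x => ⨅ y, F x y := by
  have h := (isCompact_univ (X := Y)).continuous_sInf (f := F) hF
  simp only [Set.image_univ] at h
  exact h

theorem continuous_sum_norm_blockCoeff {A B X : Type*} [Fintype A] [Fintype B]
    [TopologicalSpace X]
    {P Q : X → Matrix (A × B) (A × B) ℂ} (hP : Continuous P) (hQ : Continuous Q) :
    Continuous fun x => ∑ s, ∑ t, ‖blockCoeff (P x) (Q x) s t‖ ^ 2 := by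
  unfold blockCoeff
  exact continuous_finsetSum _ fun s _ => continuous_finsetSum _ fun t _ =>
    (continuous_finsetSum _ fun b _ => continuous_finsetSum _ fun b' _ =>
      (hP.matrix_elem _ _).mul (hQ.matrix_elem _ _)).norm.pow 2

/-- Fubini with the second variable frozen: only the design is averaged, so the other ensemble may
be arbitrary. -/
theorem integral_prod_le_of_forall {X Y : Type*} [MeasurableSpace X] [MeasurableSpace Y]
    {μ : Measure X} {ν : Measure Y} [SFinite μ] [IsProbabilityMeasure ν] {f : X × Y → ℝ}
    (hf : Integrable f (μ.prod ν)) {c : ℝ} (h : ∀ y, ∫ x, f (x, y) ∂μ ≤ c) :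
    ∫ p, f p ∂(μ.prod ν) ≤ c := by
  rw [integral_prod_symm _ hf]
  refine (integral_mono hf.integral_prod_right (integrable_const c) h).trans_eq ?_
  simp

theorem integral_prod_le_of_forall' {X Y : Type*} [MeasurableSpace X] [MeasurableSpace Y]
    {μ : Measure X} {ν : Measure Y} [IsProbabilityMeasure μ] [SFinite ν] {f : X × Y → ℝ}
    (hf : Integrable f (μ.prod ν)) {c : ℝ} (h : ∀ x, ∫ y, f (x, y) ∂ν ≤ c) :
    ∫ p, f p ∂(μ.prod ν) ≤ c := by
  rw [integral_prod _ hf]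
  refine (integral_mono hf.integral_prod_left (integrable_const c) h).trans_eq ?_
  simp

theorem two_mul_div_sq_mul_le {a d k h w : ℝ} (hd : 0 < d) (hkh : k * h ≤ d * (w ^ 2 / 4)) :
    2 * k / d ^ 2 * (a ^ 2 * h) ≤ a ^ 2 * w ^ 2 / (2 * d) := by
  calc 2 * k / d ^ 2 * (a ^ 2 * h) = 2 * a ^ 2 / d ^ 2 * (k * h) := by ring
    _ ≤ 2 * a ^ 2 / d ^ 2 * (d * (w ^ 2 / 4)) := by gcongr
    _ = a ^ 2 * w ^ 2 / (2 * d) := by field_simp; ring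

section Range

variable {A B : Type*} [Fintype A] [DecidableEq A] [Fintype B] [DecidableEq B]

theorem circuit_mem_unitaryGroup (V₁ V₂ : Matrix.unitaryGroup (A × B) ℂ)
    (UA : Matrix.unitaryGroup A ℂ) : circuit V₁ V₂ UA ∈ Matrix.unitaryGroup (A × B) ℂ :=
  mul_mem (mul_mem V₂.2 (Matrix.kronecker_mem_unitary UA.2 (one_mem _))) V₁.2

theorem trace_circuit_eq (H ρ : Matrix (A × B) (A × B) ℂ) (V₁ V₂ : Matrix.unitaryGroup (A × B) ℂ)
    (UA : Matrix.unitaryGroup A ℂ) (h r : ℂ) :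
    (H * circuit V₁ V₂ UA * ρ * (circuit V₁ V₂ UA)ᴴ).trace =
      ((V₂.1ᴴ * (H - h • (1 : Matrix (A × B) (A × B) ℂ)) * V₂.1) * (UA.1 ⊗ₖ (1 : Matrix B B ℂ)) *
        (V₁.1 * (ρ - r • (1 : Matrix (A × B) (A × B) ℂ)) * V₁.1ᴴ) *
        (UA.1 ⊗ₖ (1 : Matrix B B ℂ))ᴴ).trace +
      (h * ρ.trace + r * (H - h • (1 : Matrix (A × B) (A × B) ℂ)).trace) := by
  set C : Matrix.unitaryGroup (A × B) ℂ :=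
    ⟨circuit V₁ V₂ UA, circuit_mem_unitaryGroup V₁ V₂ UA⟩ with hC
  set H₀ := H - h • (1 : Matrix (A × B) (A × B) ℂ) with hH₀
  set ρ₀ := ρ - r • (1 : Matrix (A × B) (A × B) ℂ) with hρ₀
  have e₁ : ((V₂.1ᴴ * H₀ * V₂.1) * (UA.1 ⊗ₖ (1 : Matrix B B ℂ)) * (V₁.1 * ρ₀ * V₁.1ᴴ) *
      (UA.1 ⊗ₖ (1 : Matrix B B ℂ))ᴴ).trace = (H₀ * C.1 * ρ₀ * C.1ᴴ).trace := by
    simp only [hC, circuit, Matrix.conjTranspose_mul, mul_assoc]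
    rw [Matrix.trace_mul_comm V₂.1ᴴ]
    simp only [mul_assoc]
  have e₂ : H * C.1 * ρ * C.1ᴴ = H₀ * C.1 * ρ₀ * C.1ᴴ + h • (C.1 * ρ * C.1ᴴ) + r • H₀ := by
    have hH : H = H₀ + h • (1 : Matrix (A × B) (A × B) ℂ) := by rw [hH₀, sub_add_cancel]
    have hρ : ρ = ρ₀ + r • (1 : Matrix (A × B) (A × B) ℂ) := by rw [hρ₀, sub_add_cancel]
    have hu : H₀ * C.1 * C.1ᴴ = H₀ := by
      rw [mul_assoc, mul_conjTranspose_self_of_unitary, mul_one]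
    conv_lhs => rw [hH, add_mul, add_mul, add_mul]
    conv_lhs => enter [1]; rw [hρ]
    simp only [mul_add, add_mul, mul_smul_comm, smul_mul_assoc, mul_one, one_mul, hu]
    abel
  change (H * C.1 * ρ * C.1ᴴ).trace = _
  rw [e₁, e₂, Matrix.trace_add, Matrix.trace_add, Matrix.trace_smul, Matrix.trace_smul,
    trace_unitary_conj, smul_eq_mul, smul_eq_mul, add_assoc]

theorem variationRange_nonneg (H ρ : Matrix (A × B) (A × B) ℂ)
    (V : Matrix.unitaryGroup (A × B) ℂ × Matrix.unitaryGroup (A × B) ℂ) :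
    0 ≤ variationRange H ρ V := by
  obtain ⟨U₀, h₀, e₀⟩ := exists_isMaxOn_cost H ρ V.1 V.2
  obtain ⟨U₁, -, e₁⟩ := exists_isMinOn_cost H ρ V.1 V.2
  rw [variationRange, ← e₀, ← e₁]
  exact sub_nonneg.2 (h₀ U₁)

theorem variationRange_le_spectralWidth {H ρ : Matrix (A × B) (A × B) ℂ} (hH : H.IsHermitian)
    (hρ : IsDensityMatrix ρ)
    (V : Matrix.unitaryGroup (A × B) ℂ × Matrix.unitaryGroup (A × B) ℂ) :
    variationRange H ρ V ≤ spectralWidth H := by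
  have h : ∀ UA, cost H ρ (circuit V.1 V.2 UA) ∈
      Set.Icc (sInf (spectrum ℝ H)) (sSup (spectrum ℝ H)) := by
    intro UA
    have := (hρ.unitary_conj ⟨_, circuit_mem_unitaryGroup V.1 V.2 UA⟩).trace_mul_mem_Icc hH
    simpa only [cost, mul_assoc] using this
  exact sub_le_sub (ciSup_le fun UA => (h UA).2) (le_ciInf fun UA => (h UA).1)

theorem variationRange_sq_le {H ρ : Matrix (A × B) (A × B) ℂ}
    {V : Matrix.unitaryGroup (A × B) ℂ × Matrix.unitaryGroup (A × B) ℂ} {c L : ℝ}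
    (h : ∀ UA, (cost H ρ (circuit V.1 V.2 UA) - c) ^ 2 ≤ L) :
    variationRange H ρ V ^ 2 ≤ 4 * L := by
  obtain ⟨U₀, -, e₀⟩ := exists_isMaxOn_cost H ρ V.1 V.2
  obtain ⟨U₁, -, e₁⟩ := exists_isMinOn_cost H ρ V.1 V.2
  rw [variationRange, ← e₀, ← e₁]
  -- `(x - y)² ≤ 2 (x - c)² + 2 (y - c)²`, the defect being the square of the sum of deviations.
  nlinarith [h U₀, h U₁, sq_nonneg ((cost H ρ (circuit V.1 V.2 U₀) - c) +
    (cost H ρ (circuit V.1 V.2 U₁) - c))]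

theorem continuous_variationRange (H ρ : Matrix (A × B) (A × B) ℂ) :
    Continuous (variationRange H ρ) := by
  have hk : Continuous fun UA : Matrix.unitaryGroup A ℂ => UA.1 ⊗ₖ (1 : Matrix B B ℂ) := by
    refine continuous_matrix fun i j => ?_
    simp only [Matrix.kroneckerMap_apply]
    exact (continuous_subtype_val.matrix_elem i.1 j.1).mul continuous_const
  have hc : Continuous fun p : (Matrix.unitaryGroup (A × B) ℂ × Matrix.unitaryGroup (A × B) ℂ) ×
      Matrix.unitaryGroup A ℂ => circuit p.1.1 p.1.2 p.2 :=
    ((continuous_subtype_val.comp continuous_fst.snd).matrix_mul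
      (hk.comp continuous_snd)).matrix_mul (continuous_subtype_val.comp continuous_fst.fst)
  have h : Continuous fun p : (Matrix.unitaryGroup (A × B) ℂ × Matrix.unitaryGroup (A × B) ℂ) ×
      Matrix.unitaryGroup A ℂ => cost H ρ (circuit p.1.1 p.1.2 p.2) :=
    Complex.continuous_re.comp
      ((((continuous_const.matrix_mul hc).matrix_mul continuous_const).matrix_mul
        hc.matrix_conjTranspose).matrix_trace)
  exact (continuous_iSup_of_compactSpace h).sub (continuous_iInf_of_compactSpace h)

theorem integrable_norm_sq_sum {ν : Measure (Matrix.unitaryGroup (A × B) ℂ)} [IsFiniteMeasure ν]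
    {G : Matrix.unitaryGroup (A × B) ℂ → Matrix (A × B) (A × B) ℂ} (hG : Continuous G)
    (X : Matrix (A × B) (A × B) ℂ) :
    Integrable (fun V => ‖∑ i, ∑ j, X i j * G V i j‖ ^ 2) ν :=
  integrable_of_continuous <| (continuous_finsetSum _ fun i _ => continuous_finsetSum _ fun j _ =>
    continuous_const.mul (hG.matrix_elem i j)).norm.pow 2

/-! ### Mean square of the variation range. -/

variable {ν₁ ν₂ : Measure (Matrix.unitaryGroup (A × B) ℂ)} [IsProbabilityMeasure ν₁]
  [IsProbabilityMeasure ν₂] {H ρ : Matrix (A × B) (A × B) ℂ}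

theorem cost_sub_sq_le (H ρ : Matrix (A × B) (A × B) ℂ) (V₁ V₂ : Matrix.unitaryGroup (A × B) ℂ)
    (UA : Matrix.unitaryGroup A ℂ) (h r : ℂ) :
    (cost H ρ (circuit V₁ V₂ UA) -
        (h * ρ.trace + r * (H - h • (1 : Matrix (A × B) (A × B) ℂ)).trace).re) ^ 2 ≤
      ‖((V₂.1ᴴ * (H - h • (1 : Matrix (A × B) (A × B) ℂ)) * V₂.1) * (UA.1 ⊗ₖ (1 : Matrix B B ℂ)) *
        (V₁.1 * (ρ - r • (1 : Matrix (A × B) (A × B) ℂ)) * V₁.1ᴴ) *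
        (UA.1 ⊗ₖ (1 : Matrix B B ℂ))ᴴ).trace‖ ^ 2 := by
  rw [cost, trace_circuit_eq H ρ V₁ V₂ UA h r, Complex.add_re, add_sub_cancel_right, ← sq_abs]
  exact pow_le_pow_left₀ (abs_nonneg _) (Complex.abs_re_le_norm _) 2

theorem IsUnitaryDesign.integral_sum_norm_blockCoeff_le (hν : IsUnitaryDesign 2 ν₁)
    {K : Matrix (A × B) (A × B) ℂ} (hK : K.trace = 0) (P : Matrix (A × B) (A × B) ℂ) :
    ∫ V, ∑ s, ∑ t, ‖blockCoeff P (V.1 * K * V.1ᴴ) s t‖ ^ 2 ∂ν₁ ≤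
      2 * hsNormSq K / (Fintype.card (A × B) : ℝ) ^ 2 *
        ((Fintype.card A : ℝ) ^ 2 * hsNormSq P) :=
  VQA.integral_sum_norm_blockCoeff_le (G := fun V : Matrix.unitaryGroup (A × B) ℂ =>
    V.1 * K * V.1ᴴ) (integrable_norm_sq_sum (continuous_unitary_conj K))
    (hν.integral_norm_sq_le hK) P

theorem IsUnitaryDesign.integral_sum_norm_blockCoeff_le' (hν : IsUnitaryDesign 2 ν₂)
    {K : Matrix (A × B) (A × B) ℂ} (hK : K.trace = 0) (P : Matrix (A × B) (A × B) ℂ) :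
    ∫ V, ∑ s, ∑ t, ‖blockCoeff P (V.1ᴴ * K * V.1) s t‖ ^ 2 ∂ν₂ ≤
      2 * hsNormSq K / (Fintype.card (A × B) : ℝ) ^ 2 *
        ((Fintype.card A : ℝ) ^ 2 * hsNormSq P) :=
  VQA.integral_sum_norm_blockCoeff_le (G := fun V : Matrix.unitaryGroup (A × B) ℂ =>
    V.1ᴴ * K * V.1) (integrable_norm_sq_sum (continuous_unitary_conj' K))
    (hν.integral_norm_sq_le' hK) P

theorem integral_variationRange_sq_le_of_le
    {f : Matrix.unitaryGroup (A × B) ℂ × Matrix.unitaryGroup (A × B) ℂ → ℝ} {a w d : ℝ}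
    (hf : Integrable f (ν₁.prod ν₂)) (h₁ : ∀ V, variationRange H ρ V ^ 2 ≤ 4 * a ^ 2 * f V)
    (h₂ : ∫ V, f V ∂(ν₁.prod ν₂) ≤ a ^ 2 * w ^ 2 / (2 * d)) :
    ∫ V, variationRange H ρ V ^ 2 ∂(ν₁.prod ν₂) ≤ 2 * a ^ 4 * w ^ 2 / d := by
  calc _ ≤ ∫ V, 4 * a ^ 2 * f V ∂(ν₁.prod ν₂) :=
        integral_mono (integrable_of_continuous ((continuous_variationRange H ρ).pow 2))
          (hf.const_mul _) h₁
    _ ≤ 4 * a ^ 2 * (a ^ 2 * w ^ 2 / (2 * d)) := by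
        rw [integral_const_mul]
        exact mul_le_mul_of_nonneg_left h₂ (by positivity)
    _ = _ := by ring

theorem integral_variationRange_sq_le_of_left (hν : IsUnitaryDesign 2 ν₁) (hH : H.IsHermitian)
    (hρ : IsDensityMatrix ρ) [Nonempty (A × B)] :
    ∫ V, variationRange H ρ V ^ 2 ∂(ν₁.prod ν₂) ≤
      2 * (Fintype.card A : ℝ) ^ 4 * spectralWidth H ^ 2 / Fintype.card (A × B) := by
  -- The matrix conjugated by the design must be traceless, hence the shift of `ρ`; for `H` only the
  -- norm matters, hence the midpoint.
  set c : ℂ := (((sInf (spectrum ℝ H) + sSup (spectrum ℝ H)) / 2 : ℝ) : ℂ)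
  set K := ρ - (ρ.trace / Fintype.card (A × B)) • (1 : Matrix (A × B) (A × B) ℂ) with hK_def
  set H₀ := H - c • (1 : Matrix (A × B) (A × B) ℂ) with hH₀_def
  set f : Matrix.unitaryGroup (A × B) ℂ × Matrix.unitaryGroup (A × B) ℂ → ℝ := fun V =>
    ∑ s, ∑ t, ‖blockCoeff (V.2.1ᴴ * H₀ * V.2.1) (V.1.1 * K * V.1.1ᴴ) s t‖ ^ 2 with hf_def
  have hf : Integrable f (ν₁.prod ν₂) := integrable_of_continuous <|
    continuous_sum_norm_blockCoeff ((continuous_unitary_conj' H₀).comp continuous_snd)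
      ((continuous_unitary_conj K).comp continuous_fst)
  have h₁ : ∀ V, variationRange H ρ V ^ 2 ≤ 4 * (Fintype.card A : ℝ) ^ 2 * f V := fun V => by
    rw [mul_assoc]
    exact variationRange_sq_le fun UA =>
      (cost_sub_sq_le H ρ V.1 V.2 UA c (ρ.trace / Fintype.card (A × B))).trans
        (norm_trace_sq_le _ _ UA)
  have hK : hsNormSq K ≤ 1 := (hsNormSq_sub_trace_le ρ 0).trans (by simpa using hρ.hsNormSq_le_one)
  have hd : (0 : ℝ) < Fintype.card (A × B) := by exact_mod_cast Fintype.card_pos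
  have h₂ : ∫ V, f V ∂(ν₁.prod ν₂) ≤
      (Fintype.card A : ℝ) ^ 2 * spectralWidth H ^ 2 / (2 * Fintype.card (A × B)) := by
    refine integral_prod_le_of_forall hf fun V₂ => ?_
    have h := hν.integral_sum_norm_blockCoeff_le (trace_sub_trace_div_card ρ)
      (V₂.1ᴴ * H₀ * V₂.1)
    rw [hsNormSq_unitary_conj'] at h
    refine h.trans ?_
    refine two_mul_div_sq_mul_le hd ?_
    exact (mul_le_of_le_one_left (hsNormSq_nonneg _) hK).trans (hsNormSq_sub_midpoint_le hH)
  exact integral_variationRange_sq_le_of_le hf h₁ h₂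

theorem integral_variationRange_sq_le_of_right (hν : IsUnitaryDesign 2 ν₂) (hH : H.IsHermitian)
    (hρ : IsDensityMatrix ρ) [Nonempty (A × B)] :
    ∫ V, variationRange H ρ V ^ 2 ∂(ν₁.prod ν₂) ≤
      2 * (Fintype.card A : ℝ) ^ 4 * spectralWidth H ^ 2 / Fintype.card (A × B) := by
  set K := H - (H.trace / Fintype.card (A × B)) • (1 : Matrix (A × B) (A × B) ℂ) with hK_def
  set f : Matrix.unitaryGroup (A × B) ℂ × Matrix.unitaryGroup (A × B) ℂ → ℝ := fun V =>
    ∑ s, ∑ t, ‖blockCoeff (V.1.1 * ρ * V.1.1ᴴ) (V.2.1ᴴ * K * V.2.1) s t‖ ^ 2 with hf_def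
  have hf : Integrable f (ν₁.prod ν₂) := integrable_of_continuous <|
    continuous_sum_norm_blockCoeff ((continuous_unitary_conj ρ).comp continuous_fst)
      ((continuous_unitary_conj' K).comp continuous_snd)
  have h₁ : ∀ V, variationRange H ρ V ^ 2 ≤ 4 * (Fintype.card A : ℝ) ^ 2 * f V := fun V => by
    rw [mul_assoc]
    -- Now `H` is the traceless side; `ρ` needs no shift, its squared norm being at most one.
    refine variationRange_sq_le fun UA =>
      (cost_sub_sq_le H ρ V.1 V.2 UA (H.trace / Fintype.card (A × B)) 0).trans ?_
    rw [zero_smul, sub_zero]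
    exact norm_trace_sq_le' _ _ UA
  have hK : hsNormSq K ≤ Fintype.card (A × B) * (spectralWidth H ^ 2 / 4) :=
    (hsNormSq_sub_trace_le H _).trans (hsNormSq_sub_midpoint_le hH)
  have hd : (0 : ℝ) < Fintype.card (A × B) := by exact_mod_cast Fintype.card_pos
  have h₂ : ∫ V, f V ∂(ν₁.prod ν₂) ≤
      (Fintype.card A : ℝ) ^ 2 * spectralWidth H ^ 2 / (2 * Fintype.card (A × B)) := by
    refine integral_prod_le_of_forall' hf fun V₁ => ?_
    have h := hν.integral_sum_norm_blockCoeff_le' (trace_sub_trace_div_card H)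
      (V₁.1 * ρ * V₁.1ᴴ)
    rw [hsNormSq_unitary_conj] at h
    refine h.trans ?_
    refine two_mul_div_sq_mul_le hd ?_
    exact (mul_le_of_le_one_right (hsNormSq_nonneg _) hρ.hsNormSq_le_one).trans hK
  exact integral_variationRange_sq_le_of_le hf h₁ h₂

theorem integral_variationRange_le (hν : IsUnitaryDesign 2 ν₁ ∨ IsUnitaryDesign 2 ν₂)
    (hH : H.IsHermitian) (hρ : IsDensityMatrix ρ) :
    ∫ V, variationRange H ρ V ∂(ν₁.prod ν₂) ≤
      4 * spectralWidth H * (Fintype.card A : ℝ) ^ 2 * √((Fintype.card A : ℝ) / Fintype.card B) := by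
  have hne : Nonempty (A × B) := by
    by_contra h
    rw [not_nonempty_iff] at h
    simpa [Matrix.trace] using hρ.2
  have hsq : ∫ V, variationRange H ρ V ^ 2 ∂(ν₁.prod ν₂) ≤
      2 * (Fintype.card A : ℝ) ^ 4 * spectralWidth H ^ 2 / Fintype.card (A × B) :=
    hν.elim (integral_variationRange_sq_le_of_left · hH hρ)
      (integral_variationRange_sq_le_of_right · hH hρ)
  have hw : 0 ≤ spectralWidth H :=
    (variationRange_nonneg H ρ 1).trans (variationRange_le_spectralWidth hH hρ 1)
  have hL2 : MemLp (variationRange H ρ) 2 (ν₁.prod ν₂) :=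
    (memLp_two_iff_integrable_sq (continuous_variationRange H ρ).aestronglyMeasurable).2
      (integrable_of_continuous ((continuous_variationRange H ρ).pow 2))
  -- Nonnegativity of the variance supplies `(E Δ)² ≤ E Δ²`.
  have hvar := variance_nonneg (variationRange H ρ) (ν₁.prod ν₂)
  rw [variance_eq_sub hL2] at hvar
  have hA : (1 : ℝ) ≤ Fintype.card A := by
    exact_mod_cast Fintype.card_pos_iff.2 ⟨hne.some.1⟩
  have hB : (1 : ℝ) ≤ Fintype.card B := by
    exact_mod_cast Fintype.card_pos_iff.2 ⟨hne.some.2⟩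
  refine le_of_sq_le_sq ?_ (by positivity)
  calc _ ≤ ∫ V, variationRange H ρ V ^ 2 ∂(ν₁.prod ν₂) := by simpa using hvar
    _ ≤ _ := hsq
    -- With `d = d_A d_B` this reduces to `2 ≤ 16 d_A²`, which follows from `d_A ≥ 1`.
    _ ≤ 16 * (Fintype.card A : ℝ) ^ 4 * spectralWidth H ^ 2 * (Fintype.card A / Fintype.card B) := by
        rw [Fintype.card_prod, Nat.cast_mul, mul_div_assoc', div_le_div_iff₀ (by positivity)
          (by positivity)]
        have : 0 ≤ (Fintype.card A : ℝ) ^ 4 * spectralWidth H ^ 2 * Fintype.card B := by positivity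
        nlinarith [mul_le_mul_of_nonneg_left (one_le_pow₀ hA (n := 2)) this]
    _ = _ := by
        rw [mul_pow, Real.sq_sqrt (by positivity)]
        ring

end Range

end VQA

/-! ### Mean, variance and tail bounds, and their qubit form. -/

theorem theorem1 {A B : Type*} [Fintype A] [DecidableEq A] [Fintype B] [DecidableEq B]
    (ν₁ ν₂ : Measure (Matrix.unitaryGroup (A × B) ℂ))
    [IsProbabilityMeasure ν₁] [IsProbabilityMeasure ν₂]
    (hν : VQA.IsUnitaryDesign 2 ν₁ ∨ VQA.IsUnitaryDesign 2 ν₂)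
    (H ρ : Matrix (A × B) (A × B) ℂ) (hH : H.IsHermitian) (hρ : VQA.IsDensityMatrix ρ) :
    Integrable (VQA.variationRange H ρ) (ν₁.prod ν₂) ∧
    -- arbitrary dimensions `d_A = card A`, `d_B = card B`
    (∫ V, VQA.variationRange H ρ V ∂(ν₁.prod ν₂) ≤
        4 * VQA.spectralWidth H * (Fintype.card A : ℝ) ^ 2 *
          √((Fintype.card A : ℝ) / Fintype.card B) ∧
      variance (VQA.variationRange H ρ) (ν₁.prod ν₂) ≤
        4 * VQA.spectralWidth H ^ 2 * (Fintype.card A : ℝ) ^ 2 *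
          √((Fintype.card A : ℝ) / Fintype.card B) ∧
      ∀ ε : ℝ, 0 < ε →
        (ν₁.prod ν₂).real {V | ε ≤ VQA.variationRange H ρ V} ≤
          4 * VQA.spectralWidth H * (Fintype.card A : ℝ) ^ 2 / ε *
            √((Fintype.card A : ℝ) / Fintype.card B)) ∧
    -- `n` qubits, of which `m` belong to `A` and `n - m` to `B`
    (∀ n m : ℕ, m ≤ n → Fintype.card A = 2 ^ m → Fintype.card B = 2 ^ (n - m) →
      ∫ V, VQA.variationRange H ρ V ∂(ν₁.prod ν₂) ≤
        VQA.spectralWidth H / (2 : ℝ) ^ ((n : ℝ) / 2 - 3 * m - 2) ∧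
      variance (VQA.variationRange H ρ) (ν₁.prod ν₂) ≤
        VQA.spectralWidth H ^ 2 / (2 : ℝ) ^ ((n : ℝ) / 2 - 3 * m - 2) ∧
      ∀ ε : ℝ, 0 < ε →
        (ν₁.prod ν₂).real {V | ε ≤ VQA.variationRange H ρ V} ≤
          1 / ε * (VQA.spectralWidth H / (2 : ℝ) ^ ((n : ℝ) / 2 - 3 * m - 2))) := by
  have hint : Integrable (VQA.variationRange H ρ) (ν₁.prod ν₂) :=
    VQA.integrable_of_continuous (VQA.continuous_variationRange H ρ)
  have hmean := VQA.integral_variationRange_le hν hH hρ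
  have hw : 0 ≤ VQA.spectralWidth H :=
    (VQA.variationRange_nonneg H ρ 1).trans (VQA.variationRange_le_spectralWidth hH hρ 1)
  have hvar : variance (VQA.variationRange H ρ) (ν₁.prod ν₂) ≤
      4 * VQA.spectralWidth H ^ 2 * (Fintype.card A : ℝ) ^ 2 *
        √((Fintype.card A : ℝ) / Fintype.card B) := by
    calc _ ≤ ∫ V, VQA.variationRange H ρ V ^ 2 ∂(ν₁.prod ν₂) :=
          variance_le_expectation_sq
            (VQA.continuous_variationRange H ρ).aestronglyMeasurable
      _ ≤ ∫ V, VQA.spectralWidth H * VQA.variationRange H ρ V ∂(ν₁.prod ν₂) := by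
          refine integral_mono
            (VQA.integrable_of_continuous ((VQA.continuous_variationRange H ρ).pow 2))
            (hint.const_mul _) fun V => ?_
          simp only [sq]
          exact mul_le_mul_of_nonneg_right (VQA.variationRange_le_spectralWidth hH hρ V)
            (VQA.variationRange_nonneg H ρ V)
      _ ≤ _ := by
          rw [integral_const_mul]
          refine (mul_le_mul_of_nonneg_left hmean hw).trans_eq ?_
          ring
  have htail : ∀ ε : ℝ, 0 < ε →
      (ν₁.prod ν₂).real {V | ε ≤ VQA.variationRange H ρ V} ≤
        4 * VQA.spectralWidth H * (Fintype.card A : ℝ) ^ 2 / ε *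
          √((Fintype.card A : ℝ) / Fintype.card B) := by
    intro ε hε
    have := (mul_meas_ge_le_integral_of_nonneg
      (Filter.Eventually.of_forall (VQA.variationRange_nonneg H ρ)) hint ε).trans hmean
    rw [div_mul_eq_mul_div, le_div_iff₀ hε]
    linarith
  refine ⟨hint, ⟨hmean, hvar, htail⟩, fun n m hmn hA hB => ?_⟩
  -- The exponents of 2 add up as `2 + 2m + (m - (n - m)) / 2 = -(n/2 - 3m - 2)`.
  have key : 4 * (Fintype.card A : ℝ) ^ 2 * √((Fintype.card A : ℝ) / Fintype.card B) =
      ((2 : ℝ) ^ ((n : ℝ) / 2 - 3 * m - 2))⁻¹ := by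
    rw [hA, hB, ← Real.rpow_neg zero_le_two, Real.sqrt_eq_rpow]
    have h4 : (4 : ℝ) = 2 ^ (2 : ℝ) := by norm_num
    push_cast
    rw [← Real.rpow_natCast 2 m, ← Real.rpow_natCast 2 (n - m), ← Real.rpow_sub two_pos,
      ← Real.rpow_mul zero_le_two, ← Real.rpow_natCast, ← Real.rpow_mul zero_le_two, h4,
      ← Real.rpow_add two_pos, ← Real.rpow_add two_pos]
    congr 1
    push_cast [Nat.cast_sub hmn]
    ring
  refine ⟨hmean.trans_eq ?_, hvar.trans_eq ?_, fun ε hε => (htail ε hε).trans_eq ?_⟩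
  · rw [div_eq_mul_inv (VQA.spectralWidth H), ← key]; ring
  · rw [div_eq_mul_inv (VQA.spectralWidth H ^ 2), ← key]; ring
  · rw [div_eq_mul_inv (VQA.spectralWidth H), ← key]; ring
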